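/- Let $0<\gamma<10^{-5}$ and let $G$ be a simple graph on $n$ vertices with more than $n^2/4$ edges. Then at least one of the following two conditions holds: (a) for every integer $t$ with $3\le t\le\lceil(1/2+\gamma)n\rceil$, the graph $G$ contains the cycle $C_t$ of length $t$ as a (not necessarily induced) subgraph; (b) there exists a vertex $v$ of $G$ such that $G-v=H_1\cup H_2$, where $H_1$ and $H_2$ are vertex-disjoint subgraphs (so that no edge of $G-v$ joins $H_1$ to $H_2$) whose numbers of vertices satisfy \[ \left(\tfrac12-900\gamma\right)n<|H_1|\le|H_2|<\left(\tfrac12+900\gamma\right)n . \] -/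

import Mathlib

namespace CycleStability

open SimpleGraph Finset
open scoped Classical

universe u

variable {V : Type u}

/-! Suppose some `C_t` in the range is missing. A graph with more than n²/4 edges has cycles of
every length from 3 to its circumference (`hasCycle_of_le`), so every cycle has length at most c =
⌈(1/2+γ)n⌉ - 1. By Erdős–Gallai (`defect_nonneg`), 2e ≤ cn; since 2e > n²/2 and c < (1/2+γ)n, the
defect cn - 2e lies between 0 and εn, where ε = γn. The graph is thus nearly extremal, and it
remains to find its structure.

Deleting a vertex of degree at most c/2 does not raise the defect. Once all degrees exceed c/2, a
longest-path argument (`exists_end_block`) gives a set X with c/2 < |X| < c, attached to the rest by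
one vertex. Splitting X off lowers the defect by at least (c-1-|X|)|X|, so X has nearly c vertices
and is nearly complete.

Call the first such set A. If almost nothing else were left in the core, the vertices deleted last
would send on average about c/2 edges into A, and enough of them could be absorbed to make a cycle
longer than c (`false_of_single_dense_end`). So there is a second such set B, disjoint from A
(`exists_two_isDenseEnd`). Both are Hamiltonian connected and |A| + |B| ≥ c + 2, so two disjoint A–B
paths would close a cycle longer than c. A Menger-type argument (`exists_separating_vertex`) then
yields the cut vertex. Each side contains all but one vertex of A or of B, hence nearly n/2
vertices.

Cycles of all lengths come from induction on the vertex set: if a cycle C is longer than a missing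
length t, the set outside C is itself Hamiltonian, and Bondy's shifted-chord counts on both cycles
limit the number of edges to n²/4. -/

/-- The list `l` enumerates the vertices of a path of `G` from `a` to `b`. -/
structure IsPathList (G : SimpleGraph V) (l : List V) (a b : V) : Prop where
  chain : l.IsChain G.Adj
  nodup : l.Nodup
  head : l.head? = some a
  last : l.getLast? = some b

/-- `G` has a cycle of length `t` with all its vertices in `S`. -/
def HasCycle (G : SimpleGraph V) (S : Finset V) (t : ℕ) : Prop :=
  3 ≤ t ∧ ∃ v : ZMod t → V, Function.Injective v ∧ (∀ i, v i ∈ S) ∧ ∀ i, G.Adj (v i) (v (i + 1))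

/-- The number of neighbours of `v` in `S`. -/
noncomputable def degIn (G : SimpleGraph V) (S : Finset V) (v : V) : ℕ := #{u ∈ S | G.Adj v u}

/-- Twice the number of edges of `G` spanned by `S`. -/
noncomputable def degSum (G : SimpleGraph V) (S : Finset V) : ℕ := ∑ v ∈ S, degIn G S v

variable {G : SimpleGraph V}

/-! ### Paths as vertex lists -/

namespace IsPathList

variable {l l₁ l₂ : List V} {a b c d : V}

lemma ne_nil (h : IsPathList G l a b) : l ≠ [] := by
  rintro rfl; simpa using h.head

lemma head_mem (h : IsPathList G l a b) : a ∈ l := List.mem_of_head? h.head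

lemma last_mem (h : IsPathList G l a b) : b ∈ l := List.mem_of_getLast? h.last

lemma singleton (a : V) : IsPathList G [a] a a := ⟨by simp, by simp, rfl, rfl⟩

lemma append (h₁ : IsPathList G l₁ a b) (h₂ : IsPathList G l₂ c d) (hadj : G.Adj b c)
    (hd : ∀ x ∈ l₁, x ∉ l₂) : IsPathList G (l₁ ++ l₂) a d where
  chain := by
    refine h₁.chain.append h₂.chain ?_
    intro x hx y hy
    rw [h₁.last] at hx; rw [h₂.head] at hy
    simp only [Option.mem_def, Option.some.injEq] at hx hy
    subst hx; subst hy; exact hadj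
  nodup := List.nodup_append.2 ⟨h₁.nodup, h₂.nodup, fun x hx y hy hxy => hd x hx (hxy ▸ hy)⟩
  head := by simp [List.head?_append, h₁.head]
  last := by simp [List.getLast?_append, h₂.last]

lemma reverse (h : IsPathList G l a b) : IsPathList G l.reverse b a where
  chain := by
    rw [List.isChain_reverse]
    exact h.chain.imp fun _ _ hab => hab.symm
  nodup := List.nodup_reverse.2 h.nodup
  head := by simp [h.last]
  last := by simp [h.head]

lemma exists_split (h : IsPathList G (l₁ ++ l₂) a b) (h₁ : l₁ ≠ []) (h₂ : l₂ ≠ []) :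
    ∃ x y, IsPathList G l₁ a x ∧ IsPathList G l₂ y b ∧ G.Adj x y ∧ ∀ z ∈ l₁, z ∉ l₂ := by
  obtain ⟨x, hx⟩ : ∃ x, l₁.getLast? = some x := ⟨_, List.getLast?_eq_getLast_of_ne_nil h₁⟩
  obtain ⟨y, hy⟩ : ∃ y, l₂.head? = some y := ⟨_, List.head?_eq_some_head h₂⟩
  have hc := List.isChain_append.1 h.chain
  have hn := List.nodup_append.1 h.nodup
  have hh := h.head
  have hl := h.last
  refine ⟨x, y, ⟨hc.1, hn.1, ?_, hx⟩, ⟨hc.2.1, hn.2.1, hy, ?_⟩, hc.2.2 x hx y hy,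
    fun z hz hz' => hn.2.2 z hz z hz' rfl⟩
  · rw [List.head?_append_of_ne_nil _ h₁] at hh; exact hh
  · rw [List.getLast?_append_of_ne_nil _ h₂] at hl; exact hl

lemma mono {G' : SimpleGraph V} (hG : ∀ x ∈ l, ∀ y ∈ l, G.Adj x y → G'.Adj x y)
    (h : IsPathList G l a b) : IsPathList G' l a b where
  chain := List.IsChain.imp_of_mem_imp (fun x y hx hy hxy => hG x hx y hy hxy) h.chain
  nodup := h.nodup
  head := h.head
  last := h.last

lemma hasCycle (h : IsPathList G l a b) (hba : G.Adj b a) (hl : 3 ≤ l.length) {S : Finset V}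
    (hS : ∀ x ∈ l, x ∈ S) : HasCycle G S l.length := by
  obtain ⟨m, hm⟩ : ∃ m, l.length = m + 1 := ⟨l.length - 1, by omega⟩
  refine ⟨hl, ?_⟩
  have hpos : NeZero l.length := ⟨by omega⟩
  refine ⟨fun i => l[i.val]'(ZMod.val_lt i), ?_, fun i => hS _ (List.getElem_mem _), ?_⟩
  · intro i j hij
    exact ZMod.val_injective _ ((h.nodup.getElem_inj_iff).1 hij)
  · intro i
    have hi := ZMod.val_lt i
    have hlt1 : (1 : ZMod l.length).val = 1 := by
      have : Fact (1 < l.length) := ⟨by omega⟩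
      exact ZMod.val_one _
    by_cases hlast : i.val + 1 < l.length
    · have : (i + 1).val = i.val + 1 := by
        rw [ZMod.val_add_of_lt (by rw [hlt1]; exact hlast), hlt1]
      simp only [this]
      exact h.chain.getElem _ _
    · have h0 : (i + 1).val = 0 := by
        rw [ZMod.val_add, hlt1, show i.val + 1 = l.length by omega, Nat.mod_self]
      have hi' : i.val = l.length - 1 := by omega
      simp only [h0, hi']
      have e1 : l[l.length - 1]'(by omega) = b := by
        have := h.last
        rw [List.getLast?_eq_getElem?, List.getElem?_eq_getElem (by omega)] at this
        exact Option.some.inj this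
      have e2 : l[0]'(by omega) = a := by
        have := h.head
        rw [List.head?_eq_getElem?, List.getElem?_eq_getElem (by omega)] at this
        exact Option.some.inj this
      rw [e1, e2]; exact hba

lemma length_pos (h : IsPathList G l a b) : 0 < l.length :=
  List.length_pos_of_ne_nil h.ne_nil

/-- Consecutive values of a sequence form a path. -/
lemma arc {w : ℕ → V} {i m : ℕ} (hadj : ∀ k, G.Adj (w k) (w (k + 1)))
    (hinj : Set.InjOn w (Set.Ico i (i + m + 1))) :
    IsPathList G ((List.range' i (m + 1)).map w) (w i) (w (i + m)) where
  chain := by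
    rw [List.isChain_map]
    refine (List.isChain_range' i (m + 1) 1).imp ?_
    rintro x _ rfl
    exact hadj x
  nodup := by
    refine (List.nodup_map_iff_inj_on (List.nodup_range' )).2 ?_
    intro x hx y hy hxy
    rw [List.mem_range'_1] at hx hy
    exact hinj ⟨hx.1, by omega⟩ ⟨hy.1, by omega⟩ hxy
  head := by simp [List.range'_succ]
  last := by
    simp [List.getLast?_eq_getElem?]

end IsPathList

lemma mem_arc {w : ℕ → V} {i m : ℕ} {x : V} :
    x ∈ (List.range' i (m + 1)).map w ↔ ∃ k, i ≤ k ∧ k ≤ i + m ∧ w k = x := by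
  simp only [List.mem_map, List.mem_range'_1]
  constructor
  · rintro ⟨k, hk, rfl⟩; exact ⟨k, hk.1, by omega, rfl⟩
  · rintro ⟨k, h1, h2, rfl⟩; exact ⟨k, ⟨h1, by omega⟩, rfl⟩

/-! ### Cycles and degree sums inside a vertex set -/

lemma HasCycle.mono {S T : Finset V} (h : S ⊆ T) {t : ℕ} (hc : HasCycle G S t) :
    HasCycle G T t := by
  obtain ⟨h3, v, hv, hS, ha⟩ := hc
  exact ⟨h3, v, hv, fun i => h (hS i), ha⟩

lemma HasCycle.le_card {S : Finset V} {t : ℕ} (hc : HasCycle G S t) : t ≤ #S := by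
  obtain ⟨h3, v, hv, hS, -⟩ := hc
  have : NeZero t := ⟨by omega⟩
  calc t = #(Finset.univ.image v) := by
        rw [Finset.card_image_of_injective _ hv, Finset.card_univ, ZMod.card]
    _ ≤ #S := Finset.card_le_card fun x hx => by
        obtain ⟨i, -, rfl⟩ := Finset.mem_image.1 hx; exact hS i

lemma HasCycle.isContained {S : Finset V} {t : ℕ} (hc : HasCycle G S t) :
    (cycleGraph t).IsContained G := by
  obtain ⟨h3, v, hv, -, ha⟩ := hc
  obtain ⟨m, rfl⟩ : ∃ m, t = m + 2 := ⟨t - 2, by omega⟩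
  refine ⟨⟨⟨v, ?_⟩, hv⟩⟩
  intro i j hij
  rw [cycleGraph_adj] at hij
  rcases hij with h | h
  · have : i = j + 1 := by rw [← h]; abel
    rw [this]; exact (ha j).symm
  · have : j = i + 1 := by rw [← h]; abel
    rw [this]; exact ha i

lemma degIn_le_card (S : Finset V) (v : V) : degIn G S v ≤ #S := Finset.card_filter_le _ _

lemma degIn_le_card_sub_one {S : Finset V} {v : V} (hv : v ∈ S) : degIn G S v ≤ #S - 1 := by
  rw [← Finset.card_erase_of_mem hv]
  refine Finset.card_le_card fun x hx => ?_
  rw [Finset.mem_filter] at hx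
  exact Finset.mem_erase.2 ⟨hx.2.ne', hx.1⟩

lemma degIn_mono {S T : Finset V} (h : S ⊆ T) (v : V) : degIn G S v ≤ degIn G T v :=
  Finset.card_le_card (Finset.filter_subset_filter _ h)

lemma degIn_union {S T : Finset V} (h : Disjoint S T) (v : V) :
    degIn G (S ∪ T) v = degIn G S v + degIn G T v := by
  unfold degIn
  rw [Finset.filter_union, Finset.card_union_of_disjoint (Finset.disjoint_filter_filter h)]

lemma sum_degIn_comm (S T : Finset V) : ∑ v ∈ S, degIn G T v = ∑ v ∈ T, degIn G S v := by
  unfold degIn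
  have := Finset.sum_card_bipartiteAbove_eq_sum_card_bipartiteBelow (s := S) (t := T) G.Adj
  simp only [Finset.bipartiteAbove, Finset.bipartiteBelow] at this
  rw [this]
  simp only [G.adj_comm]

lemma degSum_union {S T : Finset V} (h : Disjoint S T) :
    degSum G (S ∪ T) = degSum G S + degSum G T + 2 * ∑ v ∈ T, degIn G S v := by
  unfold degSum
  rw [Finset.sum_union h]
  simp only [degIn_union h, Finset.sum_add_distrib]
  rw [sum_degIn_comm S T]
  ring

lemma degSum_le (S : Finset V) : degSum G S ≤ #S * (#S - 1) := by
  unfold degSum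
  calc _ ≤ ∑ v ∈ S, (#S - 1) := Finset.sum_le_sum fun v hv => degIn_le_card_sub_one hv
    _ = _ := by simp

lemma degIn_self_erase (S : Finset V) (v : V) : degIn G (S.erase v) v = degIn G S v := by
  unfold degIn
  congr 1
  ext x
  simp only [Finset.mem_filter, Finset.mem_erase]
  constructor
  · rintro ⟨⟨-, h⟩, h'⟩; exact ⟨h, h'⟩
  · rintro ⟨h, h'⟩; exact ⟨⟨h'.ne', h⟩, h'⟩

lemma degSum_erase {S : Finset V} {v : V} (hv : v ∈ S) :
    degSum G S = degSum G (S.erase v) + 2 * degIn G S v := by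
  have h : Disjoint (S.erase v) {v} := by simp
  have hu : S.erase v ∪ {v} = S := by
    rw [Finset.union_comm]; exact Finset.insert_erase hv
  have := degSum_union (G := G) h
  rw [hu] at this
  rw [this, Finset.sum_singleton, degIn_self_erase]
  simp [degSum, degIn]

/-- Replaces neighbours by their positions on the path, so that crossing arguments become counts of
integers. -/
lemma degIn_toFinset_le (l : List V) (u : V) :
    degIn G l.toFinset u ≤ #{s ∈ range l.length | ∃ x, l[s]? = some x ∧ G.Adj u x} := by
  refine Finset.card_le_card_of_injOn (fun x => l.idxOf x) ?_ ?_
  · intro x hx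
    simp only [Finset.coe_filter, List.mem_toFinset, Set.mem_ofPred_eq] at hx
    have hlt := List.idxOf_lt_length_iff.2 hx.1
    simp only [Finset.coe_filter, Finset.mem_range, Set.mem_ofPred_eq]
    exact ⟨hlt, x, by rw [List.getElem?_eq_getElem hlt, List.getElem_idxOf], hx.2⟩
  · intro x hx y hy hxy
    simp only [Finset.coe_filter, List.mem_toFinset, Set.mem_ofPred_eq] at hx hy
    exact (List.idxOf_inj hx.1).1 hxy

/-! ### Merging two paths by a crossing pair of edges -/

/-- Two disjoint paths whose facing ends `u`, `w` have many neighbours on them can be merged into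
one path on the same vertices with the same outer ends. -/
lemma exists_merged_path {P₁ P₂ : List V} {a u w b : V} (h₁ : IsPathList G P₁ a u)
    (h₂ : IsPathList G P₂ w b) (hd : ∀ x ∈ P₁, x ∉ P₂)
    (hdeg : P₁.length + P₂.length + 1 ≤
      degIn G (P₁ ++ P₂).toFinset u + degIn G (P₁ ++ P₂).toFinset w) :
    ∃ l : List V, l.Perm (P₁ ++ P₂) ∧ IsPathList G l a b := by
  by_cases huw : G.Adj u w
  · exact ⟨_, List.Perm.refl _, h₁.append h₂ huw hd⟩
  set Q := P₁ ++ P₂ with hQ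
  have hlen : Q.length = P₁.length + P₂.length := by simp [hQ]
  have hp₁ := h₁.length_pos
  have hp₂ := h₂.length_pos
  have hQu : Q[P₁.length - 1]? = some u := by
    rw [hQ, List.getElem?_append_left (by omega), ← List.getLast?_eq_getElem?]; exact h₁.last
  have hQw : Q[P₁.length]? = some w := by
    rw [hQ, List.getElem?_append_right le_rfl, Nat.sub_self, ← List.head?_eq_getElem?]
    exact h₂.head
  let I : Finset ℕ := {s ∈ range Q.length | ∃ x, Q[s]? = some x ∧ G.Adj u x}
  let J : Finset ℕ := {s ∈ range Q.length | ∃ x, Q[s]? = some x ∧ G.Adj w x}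
  have hI : degIn G Q.toFinset u ≤ #I := by
    have h := degIn_toFinset_le (G := G) Q u
    convert h
  have hJ : degIn G Q.toFinset w ≤ #J := by
    have h := degIn_toFinset_le (G := G) Q w
    convert h
  have hIu : P₁.length - 1 ∉ I := by
    intro h
    obtain ⟨x, hx, hux⟩ := (Finset.mem_filter.1 h).2
    rw [hQu] at hx; cases hx; exact G.loopless.irrefl _ hux
  have hIw : P₁.length ∉ I := by
    intro h
    obtain ⟨x, hx, hux⟩ := (Finset.mem_filter.1 h).2
    rw [hQw] at hx; cases hx; exact huw hux
  have hJu : P₁.length - 1 ∉ J := by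
    intro h
    obtain ⟨x, hx, hux⟩ := (Finset.mem_filter.1 h).2
    rw [hQu] at hx; cases hx; exact huw hux.symm
  have hJw : P₁.length ∉ J := by
    intro h
    obtain ⟨x, hx, hux⟩ := (Finset.mem_filter.1 h).2
    rw [hQw] at hx; cases hx; exact G.loopless.irrefl _ hux
  -- A crossing pair: `u` is adjacent to position s and `w` to position s + 1. These two edges
  -- replace the path edge between the positions and bridge the gap between `u` and `w`. If no such
  -- s existed, `I` shifted by one and `J` would be disjoint. Both miss position `P₁.length`, as `u`
  -- and `w` are not their own neighbours, so together they have at most `Q.length` elements, one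
  -- too few.
  obtain ⟨s, hsI, hsJ⟩ : ∃ s, s ∈ I ∧ s + 1 ∈ J := by
    by_contra! hcon
    have hdisj : Disjoint (I.image (· + 1)) J := by
      rw [Finset.disjoint_left]
      intro x hx hx'
      obtain ⟨s, hs, rfl⟩ := Finset.mem_image.1 hx
      exact hcon s hs hx'
    have hsub : I.image (· + 1) ∪ J ⊆ (range (Q.length + 1)).erase P₁.length := by
      intro x hx
      rw [Finset.mem_erase, Finset.mem_range]
      rcases Finset.mem_union.1 hx with hx | hx
      · obtain ⟨s, hs, rfl⟩ := Finset.mem_image.1 hx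
        have := Finset.mem_range.1 (Finset.mem_filter.1 hs).1
        refine ⟨fun h => hIu ?_, by omega⟩
        rw [show P₁.length - 1 = s by omega]; exact hs
      · have := Finset.mem_range.1 (Finset.mem_filter.1 hx).1
        exact ⟨fun h => hJw (h ▸ hx), by omega⟩
    have hc := Finset.card_le_card hsub
    rw [Finset.card_union_of_disjoint hdisj,
      Finset.card_image_of_injective _ (add_left_injective 1),
      Finset.card_erase_of_mem (Finset.mem_range.2 (by omega)), Finset.card_range] at hc
    omega
  obtain ⟨hs1, p, hp, hup⟩ := Finset.mem_filter.1 hsI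
  obtain ⟨hs2, q, hq, hwq⟩ := Finset.mem_filter.1 hsJ
  rw [Finset.mem_range] at hs1 hs2
  have hne1 : s ≠ P₁.length - 1 := fun h => hIu (h ▸ hsI)
  have hne2 : s ≠ P₁.length := fun h => hIw (h ▸ hsI)
  rcases lt_or_ge s P₁.length with hlt | hge
  · have hs' : s + 1 < P₁.length := by omega
    rw [hQ, List.getElem?_append_left hlt] at hp
    rw [hQ, List.getElem?_append_left hs'] at hq
    have hsplit := List.take_append_drop (s + 1) P₁
    have h₁' := h₁
    rw [← hsplit] at h₁'
    obtain ⟨x, y, hx, hy, -, hdis⟩ := h₁'.exists_split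
      (by rw [Ne, List.take_eq_nil_iff]; push Not; exact ⟨by omega, h₁.ne_nil⟩)
      (by rw [Ne, List.drop_eq_nil_iff]; omega)
    have hxp : x = p := by
      have := hx.last
      rw [List.getLast?_eq_getElem?, List.length_take, min_eq_left (by omega),
        Nat.add_sub_cancel, List.getElem?_take_of_lt (by omega), hp] at this
      exact (Option.some.inj this).symm
    have hyq : y = q := by
      have := hy.head
      rw [List.head?_drop, hq] at this
      exact (Option.some.inj this).symm
    subst hxp hyq
    have hmem : ∀ z, z ∈ P₁ ↔ z ∈ P₁.take (s + 1) ∨ z ∈ P₁.drop (s + 1) := by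
      intro z; conv_lhs => rw [← hsplit, List.mem_append]
    refine ⟨P₁.take (s + 1) ++ ((P₁.drop (s + 1)).reverse ++ P₂), ?_, ?_⟩
    · rw [← List.append_assoc, hQ]
      refine List.Perm.append_right _ ?_
      conv_rhs => rw [← hsplit]
      exact List.Perm.append_left _ (List.reverse_perm _)
    · refine hx.append (hy.reverse.append h₂ hwq.symm ?_) hup.symm ?_
      · intro z hz; exact hd z ((hmem z).2 (Or.inr (List.mem_reverse.1 hz)))
      · intro z hz hz'
        rcases List.mem_append.1 hz' with h | h
        · exact hdis z hz (List.mem_reverse.1 h)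
        · exact hd z ((hmem z).2 (Or.inl hz)) h
  · obtain ⟨r, rfl⟩ : ∃ r, s = P₁.length + r := ⟨s - P₁.length, by omega⟩
    have hr : r + 1 < P₂.length := by omega
    rw [hQ, List.getElem?_append_right (by omega), Nat.add_sub_cancel_left] at hp
    rw [hQ, List.getElem?_append_right (by omega),
      show P₁.length + r + 1 - P₁.length = r + 1 by omega] at hq
    have hsplit := List.take_append_drop (r + 1) P₂
    have h₂' := h₂
    rw [← hsplit] at h₂'
    obtain ⟨x, y, hx, hy, -, hdis⟩ := h₂'.exists_split
      (by rw [Ne, List.take_eq_nil_iff]; push Not; exact ⟨by omega, h₂.ne_nil⟩)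
      (by rw [Ne, List.drop_eq_nil_iff]; omega)
    have hxp : x = p := by
      have := hx.last
      rw [List.getLast?_eq_getElem?, List.length_take, min_eq_left (by omega),
        Nat.add_sub_cancel, List.getElem?_take_of_lt (by omega), hp] at this
      exact (Option.some.inj this).symm
    have hyq : y = q := by
      have := hy.head
      rw [List.head?_drop, hq] at this
      exact (Option.some.inj this).symm
    subst hxp hyq
    have hmem : ∀ z, z ∈ P₂ ↔ z ∈ P₂.take (r + 1) ∨ z ∈ P₂.drop (r + 1) := by
      intro z; conv_lhs => rw [← hsplit, List.mem_append]
    refine ⟨P₁ ++ ((P₂.take (r + 1)).reverse ++ P₂.drop (r + 1)), ?_, ?_⟩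
    · rw [hQ]
      refine List.Perm.append_left _ ?_
      conv_rhs => rw [← hsplit]
      exact List.Perm.append_right _ (List.reverse_perm _)
    · refine h₁.append (hx.reverse.append hy hwq ?_) hup ?_
      · intro z hz; exact hdis z (List.mem_reverse.1 hz)
      · intro z hz hz'
        refine hd z hz ((hmem z).2 ?_)
        rcases List.mem_append.1 hz' with h | h
        · exact Or.inl (List.mem_reverse.1 h)
        · exact Or.inr h

/-! ### End blocks and Dirac's theorem -/

lemma exists_greatest {P : ℕ → Prop} {N : ℕ} (h : ∃ m, P m) (hb : ∀ m, P m → m ≤ N) :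
    ∃ m, P m ∧ ∀ m', P m' → m' ≤ m := by
  obtain ⟨m, hm⟩ := h
  exact ⟨Nat.findGreatest P N, Nat.findGreatest_spec (hb m hm) hm,
    fun m' hm' => Nat.le_findGreatest (hb m' hm') hm'⟩

lemma IsPathList.length_le_card {l : List V} {a b : V} (h : IsPathList G l a b) {S : Finset V}
    (hS : ∀ x ∈ l, x ∈ S) : l.length ≤ #S := by
  rw [← List.toFinset_card_of_nodup h.nodup]
  exact Finset.card_le_card fun x hx => hS x (List.mem_toFinset.1 hx)

/-- In a graph of minimum degree at least `d` without cycles of length `2 * d` or more, some set of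
at least `d` vertices is attached to the rest by at most one vertex and spans, together with that
vertex, a Hamiltonian graph. -/
lemma exists_end_block {S : Finset V} {c d : ℕ} (hS : S.Nonempty) (hd : 2 ≤ d)
    (hdeg : ∀ v ∈ S, d ≤ degIn G S v) (hcyc : ∀ t, HasCycle G S t → t ≤ c) (hcd : c < 2 * d) :
    ∃ X ⊆ S, ∃ b ∈ S, b ∉ X ∧ d ≤ #X ∧ #X + 1 ≤ c ∧
      ∀ y ∈ X, ∀ z ∈ S, G.Adj y z → z ∈ insert b X := by
  obtain ⟨v₀, hv₀⟩ := hS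
  obtain ⟨L, ⟨l, a₀, b₀, hl, hlS, hlL⟩, hLmax⟩ := exists_greatest
    (P := fun m => ∃ l a b, IsPathList G l a b ∧ (∀ x ∈ l, x ∈ S) ∧ l.length = m) (N := #S)
    ⟨1, [v₀], v₀, v₀, IsPathList.singleton v₀, by simpa using hv₀, rfl⟩
    (by rintro m ⟨l, a, b, h, hS, rfl⟩; exact h.length_le_card hS)
  have hext : ∀ l a b, IsPathList G l a b → (∀ x ∈ l, x ∈ S) → l.length = L →
      ∀ z ∈ S, G.Adj a z → z ∈ l := by
    intro l a b h hS hL z hz haz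
    by_contra hzl
    have h' := (IsPathList.singleton (G := G) z).append h haz.symm (by simpa using hzl)
    have := hLmax _ ⟨_, _, _, h', by simpa using ⟨hz, hS⟩, rfl⟩
    simp at this
    omega
  -- Among the longest paths, take one whose first vertex `a` has a neighbour `y` as far along as
  -- possible. The segment `K` from `a` to `y` closes to a cycle.
  obtain ⟨k, ⟨K, R, a, y, b, hKR, hKS, hKL, hKk, hK, hay⟩, hkmax⟩ := exists_greatest
    (P := fun k => ∃ K R a y b, IsPathList G (K ++ R) a b ∧ (∀ x ∈ K ++ R, x ∈ S) ∧
      (K ++ R).length = L ∧ K.length = k ∧ IsPathList G K a y ∧ G.Adj a y) (N := L)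
    (by
      have h1 : 0 < degIn G S a₀ := by have := hdeg a₀ (hlS _ hl.head_mem); omega
      obtain ⟨z, hz⟩ := Finset.card_pos.1 h1
      rw [Finset.mem_filter] at hz
      obtain ⟨s, t, rfl⟩ := List.append_of_mem (hext l a₀ b₀ hl hlS hlL z hz.1 hz.2)
      refine ⟨_, s ++ [z], t, a₀, z, b₀, by simpa using hl, by simpa using hlS, by simpa using hlL,
        rfl, ?_, hz.2⟩
      have hl' : IsPathList G ((s ++ [z]) ++ t) a₀ b₀ := by simpa using hl
      refine ⟨hl'.chain.left_of_append, (List.nodup_append.1 hl'.nodup).1, ?_, by simp⟩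
      have := hl'.head
      rwa [List.head?_append_of_ne_nil _ (by simp)] at this)
    (by rintro m ⟨K, R, a, y, b, -, -, h, rfl, -⟩; simp at h; omega)
  have hmax : ∀ K' R' a' b', IsPathList G (K' ++ R') a' b' → (∀ x ∈ K' ++ R', x ∈ S) →
      (K' ++ R').length = L → K'.length = k → ∀ z ∈ S, G.Adj a' z → z ∈ K' := by
    intro K' R' a' b' h hS' hL hk z hz haz
    rcases List.mem_append.1 (hext _ _ _ h hS' hL z hz haz) with h1 | h1
    · exact h1
    · exfalso
      obtain ⟨s, t, rfl⟩ := List.append_of_mem h1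
      have h' : IsPathList G ((K' ++ s ++ [z]) ++ t) a' b' := by simpa using h
      have := hkmax _ ⟨K' ++ s ++ [z], t, a', z, b', h', by simpa using hS', by simpa using hL,
        rfl, ⟨h'.chain.left_of_append, (List.nodup_append.1 h'.nodup).1, ?_, by simp⟩, haz⟩
      · simp at this; omega
      · have := h'.head
        rwa [List.head?_append_of_ne_nil _ (by simp)] at this
  -- A Hamiltonian path of `K` ending at `y` can replace `K` in the longest path, so by both
  -- maximalities its first vertex has all its neighbours in `K`.
  have hT : ∀ K' y', K'.Perm K → IsPathList G K' y' y → ∀ z ∈ S, G.Adj y' z → z ∈ K := by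
    intro K' y' hp h' z hz hyz
    refine hp.mem_iff.1 ?_
    by_cases hR : R = []
    · subst hR
      refine hmax K' [] y' y (by simpa using h') ?_ ?_ (hp.length_eq.trans hKk) z hz hyz
      · intro x hx
        rw [List.append_nil] at hx
        exact hKS x (by simpa using hp.mem_iff.1 hx)
      · simpa [hp.length_eq] using hKL
    · obtain ⟨x, r, hx, hr, hxr, hdis⟩ := hKR.exists_split hK.ne_nil hR
      have hxy : x = y := Option.some.inj (hx.last.symm.trans hK.last)
      subst hxy
      refine hmax K' R y' b (h'.append hr hxr fun z hz => hdis z (hp.mem_iff.1 hz)) ?_ ?_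
        (hp.length_eq.trans hKk) z hz hyz
      · intro w hw
        refine hKS w ?_
        rw [List.mem_append] at hw ⊢
        exact hw.imp_left hp.mem_iff.1
      · rw [List.length_append, hp.length_eq, ← List.length_append]; exact hKL
  have hKdeg : ∀ K' y', K'.Perm K → IsPathList G K' y' y → d ≤ degIn G K.toFinset y' := by
    intro K' y' hp h'
    refine (hdeg y' (hKS _ (List.mem_append_left _ (hp.mem_iff.1 h'.head_mem)))).trans ?_
    refine Finset.card_le_card fun z hz => ?_
    rw [Finset.mem_filter] at hz ⊢
    exact ⟨List.mem_toFinset.2 (hT K' y' hp h' z hz.1 hz.2), hz.2⟩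
  have hKcard : #K.toFinset = k := by rw [List.toFinset_card_of_nodup hK.nodup, hKk]
  have hkd : d + 1 ≤ k := by
    have h1 := hKdeg K a (List.Perm.refl _) hK
    have h2 := degIn_le_card_sub_one (G := G) (List.mem_toFinset.2 hK.head_mem)
    omega
  have hkc : k ≤ c := by
    refine hcyc k ?_
    rw [← hKk]
    exact hK.hasCycle hay.symm (by omega) fun x hx => hKS x (List.mem_append_left _ hx)
  -- Working back from `y`, every other vertex of `K` starts a Hamiltonian path of `K` ending at
  -- `y`. The part up to x, reversed, ends at `a`; it is merged with the part from the next vertex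
  -- `w` to `y`. By induction `w` also has degree at least d in `K`, and 2d > c ≥ |K|.
  have hdesc : ∀ B A : List V, A ≠ [] → B ≠ [] → A ++ B = K →
      ∃ x K', A.getLast? = some x ∧ K'.Perm K ∧ IsPathList G K' x y := by
    intro B
    induction B with
    | nil => intro A _ h; exact absurd rfl h
    | cons w B ih =>
      intro A hA hB hAB
      have hK' := hK
      rw [← hAB] at hK'
      obtain ⟨x, w', hx, hw, hxw, hdis⟩ := hK'.exists_split hA hB
      have hw' : w = w' := by simpa using hw.head
      subst hw'
      have hperm : (A.reverse ++ (w :: B)).Perm K := by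
        rw [← hAB]; exact List.Perm.append_right _ (List.reverse_perm _)
      have hdis' : ∀ z ∈ A.reverse, z ∉ w :: B := fun z hz => hdis z (List.mem_reverse.1 hz)
      by_cases hB' : B = []
      · subst hB'
        have : w = y := by simpa using hw.last
        subst this
        exact ⟨x, _, hx.last, hperm, hx.reverse.append hw hay hdis'⟩
      · obtain ⟨x', K', hx', hp', hpath⟩ := ih (A ++ [w]) (by simp) hB' (by simpa using hAB)
        have : w = x' := by simpa using hx'
        subst this
        have hfin : (A.reverse ++ (w :: B)).toFinset = K.toFinset := by
          ext z; simp only [List.mem_toFinset]; exact hperm.mem_iff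
        obtain ⟨l, hlp, hlpath⟩ := exists_merged_path hx.reverse hw hdis' (by
          rw [hfin, ← List.length_append, hperm.length_eq]
          have h1 := hKdeg K a (List.Perm.refl _) hK
          have h2 := hKdeg K' w hp' hpath
          omega)
        exact ⟨x, l, hx.last, hlp.trans hperm, hlpath⟩
  refine ⟨K.toFinset.erase y, ?_, y, hKS _ (List.mem_append_left _ hK.last_mem), by simp, ?_, ?_, ?_⟩
  · intro x hx
    exact hKS x (List.mem_append_left _ (List.mem_toFinset.1 (Finset.mem_of_mem_erase hx)))
  · rw [Finset.card_erase_of_mem (List.mem_toFinset.2 hK.last_mem)]; omega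
  · rw [Finset.card_erase_of_mem (List.mem_toFinset.2 hK.last_mem)]; omega
  · intro x hx z hz hxz
    rw [Finset.mem_erase, List.mem_toFinset] at hx
    rw [Finset.insert_erase (List.mem_toFinset.2 hK.last_mem), List.mem_toFinset]
    obtain ⟨s, t, hst⟩ := List.append_of_mem hx.2
    have ht : t ≠ [] := by
      rintro rfl
      have := hK.last
      rw [hst] at this
      simp at this
      exact hx.1 this
    obtain ⟨x', K', hx', hp', hpath⟩ := hdesc t (s ++ [x]) (by simp) ht (by simp [hst])
    have : x = x' := by simpa using hx'
    subst this
    exact hT K' x hp' hpath z hz hxz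

/-- Dirac's theorem. -/
lemma hasCycle_card_of_minDegree {S : Finset V} (h3 : 3 ≤ #S)
    (hdeg : ∀ v ∈ S, #S ≤ 2 * degIn G S v) : HasCycle G S #S := by
  by_contra hno
  have hcyc : ∀ t, HasCycle G S t → t ≤ #S - 1 := by
    intro t ht
    have := ht.le_card
    have hne : t ≠ #S := fun h => hno (h ▸ ht)
    omega
  -- Without a Hamiltonian cycle the circumference is below 2d for d = ⌈|S|/2⌉. The end block then
  -- has at least d vertices besides its attachment, leaving too few possible neighbours for a
  -- vertex outside it.
  obtain ⟨X, hXS, b, hb, hbX, hdX, hXc, hX⟩ := exists_end_block (G := G) (S := S)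
    (d := (#S + 1) / 2) (Finset.card_pos.1 (by omega)) (by omega)
    (fun v hv => by have := hdeg v hv; omega) hcyc (by omega)
  have hsub : insert b X ⊆ S := Finset.insert_subset hb hXS
  have hcard : #(insert b X) = #X + 1 := Finset.card_insert_of_notMem hbX
  obtain ⟨z, hzS, hz⟩ : ∃ z ∈ S, z ∉ insert b X := by
    by_contra! h
    have := Finset.card_le_card (show S ⊆ insert b X from h)
    omega
  have hzdeg : degIn G S z ≤ #(S \ X) - 1 := by
    have hzm : z ∈ S \ X := by
      rw [Finset.mem_sdiff]; exact ⟨hzS, fun h => hz (Finset.mem_insert_of_mem h)⟩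
    refine le_trans (Finset.card_le_card fun w hw => ?_) (degIn_le_card_sub_one (G := G) hzm)
    rw [Finset.mem_filter] at hw ⊢
    refine ⟨Finset.mem_sdiff.2 ⟨hw.1, fun hwX => hz (hX w hwX z hzS hw.2.symm)⟩, hw.2⟩
  rw [Finset.card_sdiff_of_subset hXS] at hzdeg
  have := hdeg z hzS
  omega

/-! ### Hamiltonian connectedness by closure -/

/-- Adding an edge between vertices of large degree does not create new Hamiltonian connections. -/
lemma exists_hamiltonPath_of_sup_edge {S : Finset V} {u w a b : V}
    (hdeg : #S + 1 ≤ degIn G S u + degIn G S w) {l : List V} (hlS : l.toFinset = S)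
    (hl : IsPathList (G ⊔ edge u w) l a b) :
    ∃ l : List V, l.toFinset = S ∧ IsPathList G l a b := by
  by_cases hc : l.IsChain G.Adj
  · exact ⟨l, hlS, hc, hl.nodup, hl.head, hl.last⟩
  obtain ⟨n, hn, hnadj⟩ := List.exists_not_getElem_of_not_isChain hc
  have hsplit := List.take_append_drop (n + 1) l
  have hl' := hl
  rw [← hsplit] at hl'
  obtain ⟨x, y, hx, hy, hxy, hdis⟩ := hl'.exists_split
    (by rw [Ne, List.take_eq_nil_iff]; push Not; exact ⟨by omega, hl.ne_nil⟩)
    (by rw [Ne, List.drop_eq_nil_iff]; omega)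
  have hxp : x = l[n] := by
    have := hx.last
    rw [List.getLast?_eq_getElem?, List.length_take, min_eq_left (by omega),
      Nat.add_sub_cancel, List.getElem?_take_of_lt (by omega),
      List.getElem?_eq_getElem (by omega)] at this
    exact (Option.some.inj this).symm
  have hyq : y = l[n + 1] := by
    have := hy.head
    rw [List.head?_drop, List.getElem?_eq_getElem (by omega)] at this
    exact (Option.some.inj this).symm
  rw [← hxp, ← hyq] at hnadj
  have huw : (x = u ∧ y = w) ∨ (x = w ∧ y = u) := by
    rw [sup_adj, edge_adj] at hxy
    rcases hxy with h | h
    · exact absurd h hnadj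
    · rcases h.1 with h | h
      · exact Or.inl h
      · exact Or.inr h
  have hxm := hx.last_mem
  have hym := hy.head_mem
  -- The new edge occurs only as xy, so both halves of the path are paths of `G` and can be merged
  -- at x and y.
  have key : ∀ p q, (G ⊔ edge u w).Adj p q → ¬ (p = x ∧ q = y) → ¬ (p = y ∧ q = x) →
      G.Adj p q := by
    intro p q hpq h1 h2
    rw [sup_adj, edge_adj] at hpq
    rcases hpq with h | h
    · exact h
    · exfalso
      rcases huw with ⟨rfl, rfl⟩ | ⟨rfl, rfl⟩ <;> rcases h.1 with ⟨rfl, rfl⟩ | ⟨rfl, rfl⟩ <;>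
        simp at h1 h2
  have hx' := hx.mono (G' := G) fun p hp q hq hpq => key p q hpq
    (fun h => hdis q hq (h.2 ▸ hym)) (fun h => hdis p hp (h.1 ▸ hym))
  have hy' := hy.mono (G' := G) fun p hp q hq hpq => key p q hpq
    (fun h => hdis x hxm (h.1 ▸ hp)) (fun h => hdis x hxm (h.2 ▸ hq))
  obtain ⟨m, hmp, hm⟩ := exists_merged_path hx' hy' hdis (by
    rw [hsplit, hlS, ← List.length_append, hsplit, ← List.toFinset_card_of_nodup hl.nodup, hlS]
    rcases huw with ⟨rfl, rfl⟩ | ⟨rfl, rfl⟩ <;> omega)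
  refine ⟨m, ?_, hm⟩
  rw [← hlS]
  ext z
  simp only [List.mem_toFinset]
  rw [hmp.mem_iff, hsplit]

/-- A Chvátal-type condition for Hamiltonian connectedness. -/
lemma exists_hamiltonPath {S T : Finset V} (hTS : T ⊆ S) (hT : #S + 1 ≤ 2 * #T) {a b : V}
    (ha : a ∈ S) (hb : b ∈ S) (hab : a ≠ b) (G : SimpleGraph V)
    (hdeg : ∀ x ∈ T, ∀ y ∈ S, x ≠ y → #S + 1 ≤ degIn G S x + degIn G S y) :
    ∃ l : List V, l.toFinset = S ∧ IsPathList G l a b := by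
  -- Bondy–Chvátal closure: edges are added between non-adjacent vertices of degree sum above |S|
  -- until none is left to add.
  induction hN : #{p ∈ S ×ˢ S | ¬ G.Adj p.1 p.2} using Nat.strong_induction_on generalizing G with
  | _ N ih =>
  by_cases hex : ∃ u ∈ S, ∃ w ∈ S, u ≠ w ∧ ¬ G.Adj u w ∧ #S + 1 ≤ degIn G S u + degIn G S w
  · obtain ⟨u, hu, w, hw, huw, hnadj, hsum⟩ := hex
    obtain ⟨G', hG'⟩ : ∃ G', G' = G ⊔ edge u w := ⟨_, rfl⟩
    have hGG' : ∀ x y, G.Adj x y → G'.Adj x y := fun x y h => hG' ▸ Or.inl h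
    have huw' : G'.Adj u w := by rw [hG', sup_adj, edge_adj]; exact Or.inr ⟨Or.inl ⟨rfl, rfl⟩, huw⟩
    have hle : ∀ x, degIn G S x ≤ degIn G' S x := fun x =>
      Finset.card_le_card fun y hy => by
        rw [Finset.mem_filter] at hy ⊢
        exact ⟨hy.1, hGG' _ _ hy.2⟩
    obtain ⟨l, hlS, hl⟩ := ih _ (by
      rw [← hN]
      refine Finset.card_lt_card ?_
      rw [Finset.ssubset_iff_of_subset]
      · refine ⟨(u, w), by simp [hu, hw, hnadj], ?_⟩
        simp [huw']
      · intro p hp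
        rw [Finset.mem_filter] at hp ⊢
        exact ⟨hp.1, fun h => hp.2 (hGG' _ _ h)⟩) G'
      (fun x hx y hy hxy => (hdeg x hx y hy hxy).trans (Nat.add_le_add (hle x) (hle y))) rfl
    exact exists_hamiltonPath_of_sup_edge hsum hlS (hG' ▸ hl)
  · push Not at hex
    have hTadj : ∀ x ∈ T, ∀ y ∈ S, x ≠ y → G.Adj x y := by
      intro x hx y hy hxy
      by_contra hn
      have h1 := hex x (hTS hx) y hy hxy hn
      have h2 := hdeg x hx y hy hxy
      omega
    -- In the closure `T` is joined to everything, so two non-adjacent vertices lie outside `T` and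
    -- each has at least |T| neighbours. Their degree sum exceeds |S|, against closedness.
    have hcomplete : ∀ x ∈ S, ∀ y ∈ S, x ≠ y → G.Adj x y := by
      intro x hx y hy hxy
      by_contra hn
      have hxT : x ∉ T := fun h => hn (hTadj x h y hy hxy)
      have hyT : y ∉ T := fun h => hn (hTadj y h x hx hxy.symm).symm
      have hd : ∀ z ∈ S, z ∉ T → #T ≤ degIn G S z := by
        intro z hz hzT
        refine Finset.card_le_card fun p hp => ?_
        rw [Finset.mem_filter]
        exact ⟨hTS hp, (hTadj p hp z hz fun h => hzT (h ▸ hp)).symm⟩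
      have h1 := hd x hx hxT
      have h2 := hd y hy hyT
      have h3 := hex x hx y hy hxy hn
      omega
    set l : List V := a :: (((S.erase a).erase b).toList ++ [b]) with hl
    have hmem : ∀ z, z ∈ l ↔ z ∈ S := by
      intro z
      simp only [hl, List.mem_cons, List.mem_append, Finset.mem_toList, Finset.mem_erase,
        List.not_mem_nil, or_false]
      constructor
      · rintro (rfl | h | rfl)
        exacts [ha, h.2.2, hb]
      · intro h
        by_cases h1 : z = a
        · exact Or.inl h1
        · by_cases h2 : z = b
          · exact Or.inr (Or.inr h2)
          · exact Or.inr (Or.inl ⟨h2, h1, h⟩)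
    have hnd : l.Nodup := by
      simp +contextual [hl, List.nodup_append, hab, Finset.nodup_toList]
    refine ⟨l, by ext z; simp [hmem], ?_, hnd, by simp [hl], ?_⟩
    · refine List.Pairwise.isChain ?_
      have := List.Pairwise.and_mem.1 hnd
      exact this.imp fun {x y} h => hcomplete x ((hmem x).1 h.1) y ((hmem y).1 h.2.1) h.2.2
    · simp [hl, List.getLast?_cons]

/-! ### Chords of a cycle and Bondy's theorem -/

section CyclicSequence

variable {c : ℕ} {v : ZMod c → V}

lemma injOn_cyclic (hv : Function.Injective v) (j : ZMod c) (i : ℕ) :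
    Set.InjOn (fun k : ℕ => v (j + k)) (Set.Ico i (i + c)) := by
  have key : ∀ k k' : ℕ, i ≤ k → k' < i + c → k ≤ k' → v (j + k) = v (j + k') → k = k' := by
    intro k k' h1 h2 h h'
    have h3 : (k : ZMod c) = k' := add_left_cancel (hv h')
    rw [ZMod.natCast_eq_natCast_iff, Nat.modEq_iff_dvd' h] at h3
    have := Nat.eq_zero_of_dvd_of_lt h3 (by omega)
    omega
  intro k hk k' hk' h
  rcases le_total k k' with h1 | h1
  · exact key k k' hk.1 hk'.2 h1 h
  · exact (key k' k hk'.1 hk.2 h1 h.symm).symm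

lemma adj_cyclic (ha : ∀ i, G.Adj (v i) (v (i + 1))) (j : ZMod c) (k : ℕ) :
    G.Adj (v (j + k)) (v (j + (k + 1 : ℕ))) := by
  have := ha (j + k)
  rwa [add_assoc, ← Nat.cast_succ] at this

/-- A path outside a cycle together with an arc of the cycle. -/
lemma hasCycle_of_path_of_arc (hv : Function.Injective v) (ha : ∀ i, G.Adj (v i) (v (i + 1)))
    {S : Finset V} (hvS : ∀ i, v i ∈ S) {l : List V} {x y : V} (hl : IsPathList G l y x)
    (hlS : ∀ z ∈ l, z ∈ S) (hlv : ∀ z ∈ l, ∀ i, v i ≠ z) {j : ZMod c} {q : ℕ} (hq : q < c)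
    (hx : G.Adj x (v j)) (hy : G.Adj y (v (j + q))) (h3 : 3 ≤ l.length + (q + 1)) :
    HasCycle G S (l.length + (q + 1)) := by
  have parc := IsPathList.arc (w := fun k : ℕ => v (j + k)) (i := 0) (m := q)
    (fun k => adj_cyclic ha j k)
    ((injOn_cyclic hv j 0).mono (Set.Ico_subset_Ico (by omega) (by omega)))
  simp only [Nat.cast_zero, add_zero, zero_add] at parc
  have p := hl.append parc hx (by
    intro z hz hz'
    rw [mem_arc] at hz'
    obtain ⟨k, -, -, h⟩ := hz'
    exact hlv z hz _ h)
  have hlen : (l ++ (List.range' 0 (q + 1)).map fun k : ℕ => v (j + k)).length =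
    l.length + (q + 1) := by simp
  rw [← hlen]
  refine p.hasCycle hy.symm (by rw [hlen]; exact h3) ?_
  intro z hz
  rw [List.mem_append, mem_arc] at hz
  rcases hz with hz | ⟨k, -, -, rfl⟩
  · exact hlS z hz
  · exact hvS _

variable [NeZero c]

/-- Any window of c consecutive integers indexes the cycle once. Neighbours can therefore be counted
in an integer interval whose start is chosen to suit the argument. -/
lemma degIn_cyclic (hv : Function.Injective v) (j : ZMod c) (i : ℕ) (x : V) :
    degIn G (univ.image v) x = #{k ∈ Finset.Ico i (i + c) | G.Adj x (v (j + (k : ℕ)))} := by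
  unfold degIn
  rw [← Finset.card_image_of_injOn (f := fun k : ℕ => v (j + k))
    (s := {k ∈ Finset.Ico i (i + c) | G.Adj x (v (j + (k : ℕ)))})]
  · congr 1
    ext z
    simp only [Finset.mem_filter, Finset.mem_image, Finset.mem_univ, true_and, Finset.mem_Ico]
    constructor
    · rintro ⟨⟨r, rfl⟩, hx⟩
      refine ⟨i + (r - j - i : ZMod c).val, ⟨⟨by omega, ?_⟩, ?_⟩, ?_⟩
      · have := ZMod.val_lt (r - j - i : ZMod c); omega
      · push_cast
        rw [ZMod.natCast_rightInverse]
        convert hx using 2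
        ring
      · push_cast
        rw [ZMod.natCast_rightInverse]
        congr 1
        ring
    · rintro ⟨k, ⟨-, hx⟩, rfl⟩
      exact ⟨⟨_, rfl⟩, hx⟩
  · refine (injOn_cyclic hv j i).mono fun k hk => ?_
    have := Finset.mem_Ico.1 (Finset.mem_filter.1 hk).1
    exact ⟨this.1, this.2⟩

lemma degIn_image_eq (hv : Function.Injective v) (x : V) :
    degIn G (univ.image v) x = #{i : ZMod c | G.Adj x (v i)} := by
  unfold degIn
  rw [Finset.filter_image, Finset.card_image_of_injective _ hv]

lemma card_image_cyclic (hv : Function.Injective v) : #(univ.image v) = c := by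
  rw [Finset.card_image_of_injective _ hv, Finset.card_univ, ZMod.card]

/-- Turns a bound for each pair of consecutive vertices into a bound for the whole sum. -/
lemma sum_image_cyclic (hv : Function.Injective v) (f : V → ℕ) :
    2 * ∑ x ∈ univ.image v, f x = ∑ i : ZMod c, (f (v i) + f (v (i + 1))) := by
  rw [Finset.sum_image fun _ _ _ _ h => hv h, Finset.sum_add_distrib]
  have : ∑ i : ZMod c, f (v (i + 1)) = ∑ i : ZMod c, f (v i) :=
    Fintype.sum_equiv (Equiv.addRight 1) _ _ fun _ => rfl
  rw [this, two_mul]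

/-- If `G` has a Hamiltonian cycle on the image of `v` but no cycle of length `t`, the degrees of
consecutive vertices have sum at most `c`. -/
lemma degIn_add_degIn_le (hv : Function.Injective v) (ha : ∀ i, G.Adj (v i) (v (i + 1)))
    {t : ℕ} (ht : 3 ≤ t) (htc : t < c) (hno : ¬ HasCycle G (univ.image v) t) (j : ZMod c) :
    degIn G (univ.image v) (v j) + degIn G (univ.image v) (v (j + 1)) ≤ c := by
  set w : ℕ → V := fun k => v (j + k) with hw
  have hwadj : ∀ k, G.Adj (w k) (w (k + 1)) := fun k => adj_cyclic ha j k
  have hwinj : ∀ i, Set.InjOn w (Set.Ico i (i + c)) := fun i => injOn_cyclic hv j i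
  have hwC : ∀ k, w k ∈ univ.image v := fun k => Finset.mem_image_of_mem _ (Finset.mem_univ _)
  have hw0 : w 0 = v j := by simp [hw]
  have hw1 : w 1 = v (j + 1) := by simp [hw]
  have hwc : w c = w 0 := by simp [hw]
  let I : Finset ℕ := {k ∈ Finset.Ico 2 c | G.Adj (w 0) (w k)}
  let J : Finset ℕ := {k ∈ Finset.Ico 2 c | G.Adj (w 1) (w k)}
  have hI : degIn G (univ.image v) (w 0) ≤ #I + 1 := by
    rw [degIn_cyclic hv j 0]
    refine le_trans (Finset.card_le_card (t := insert 1 I) fun k hk => ?_)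
      (Finset.card_insert_le _ _)
    rw [Finset.mem_filter, Finset.mem_Ico] at hk
    rw [Finset.mem_insert, Finset.mem_filter, Finset.mem_Ico]
    have : k ≠ 0 := by rintro rfl; exact G.loopless.irrefl _ hk.2
    by_cases h1 : k = 1
    · exact Or.inl h1
    · exact Or.inr ⟨⟨by omega, by omega⟩, hk.2⟩
  have hJ : degIn G (univ.image v) (w 1) ≤ #J + 1 := by
    rw [degIn_cyclic hv j 0]
    refine le_trans (Finset.card_le_card (t := insert 0 J) fun k hk => ?_)
      (Finset.card_insert_le _ _)
    rw [Finset.mem_filter, Finset.mem_Ico] at hk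
    rw [Finset.mem_insert, Finset.mem_filter, Finset.mem_Ico]
    have : k ≠ 1 := by rintro rfl; exact G.loopless.irrefl _ hk.2
    by_cases h1 : k = 0
    · exact Or.inl h1
    · exact Or.inr ⟨⟨by omega, by omega⟩, hk.2⟩
  -- A permutation of [2, c-1] that pairs a chord `w 0`–`w a` with the chord `w 1`–`w (φ a)`. If
  -- both are present they close a cycle on exactly t vertices: crossing and using two arcs when a ≤
  -- t - 2, using one arc and the edge `w 0`–`w 1` otherwise. So |I| + |J| ≤ c - 2.
  let φ : ℕ → ℕ := fun a => if a ≤ t - 2 then a + c + 1 - t else a + 3 - t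
  have hφinj : Set.InjOn φ I := by
    intro a ha' b hb' hab
    have h1 := Finset.mem_Ico.1 (Finset.mem_filter.1 ha').1
    have h2 := Finset.mem_Ico.1 (Finset.mem_filter.1 hb').1
    simp only [φ] at hab
    split_ifs at hab <;> omega
  have hdisj : Disjoint (I.image φ) J := by
    rw [Finset.disjoint_left]
    intro b hb hbJ
    obtain ⟨a, haI, rfl⟩ := Finset.mem_image.1 hb
    obtain ⟨haI, h0a⟩ := Finset.mem_filter.1 haI
    obtain ⟨hbI, h1b⟩ := Finset.mem_filter.1 hbJ
    rw [Finset.mem_Ico] at haI hbI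
    apply hno
    by_cases hat : a ≤ t - 2
    · simp only [φ, if_pos hat] at h1b hbI
      obtain ⟨b, hb⟩ : ∃ b, a + c + 1 - t = b := ⟨_, rfl⟩
      rw [hb] at h1b hbI
      have p1 := (IsPathList.arc (i := 1) (m := a - 1) hwadj
        ((hwinj 1).mono (Set.Ico_subset_Ico (by omega) (by omega)))).reverse
      have p2 := IsPathList.arc (i := b) (m := c - b) hwadj
        ((hwinj 1).mono (Set.Ico_subset_Ico (by omega) (by omega)))
      rw [show 1 + (a - 1) = a by omega] at p1
      rw [show b + (c - b) = c by omega, hwc] at p2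
      have p := p1.append p2 h1b (by
        intro x hx hx'
        rw [List.mem_reverse, mem_arc] at hx
        rw [mem_arc] at hx'
        obtain ⟨k, hk1, hk2, rfl⟩ := hx
        obtain ⟨k', hk1', hk2', h⟩ := hx'
        have := hwinj 1 ⟨by omega, by omega⟩ ⟨by omega, by omega⟩ h
        omega)
      have hlen : ((List.range' 1 (a - 1 + 1)).map w).reverse.length +
        ((List.range' b (c - b + 1)).map w).length = t := by simp; omega
      rw [← hlen, ← List.length_append]
      refine p.hasCycle h0a (by rw [List.length_append, hlen]; exact ht) ?_
      intro x hx
      rw [List.mem_append, List.mem_reverse, mem_arc, mem_arc] at hx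
      rcases hx with ⟨k, -, -, rfl⟩ | ⟨k, -, -, rfl⟩ <;> exact hwC k
    · simp only [φ, if_neg hat] at h1b hbI
      obtain ⟨b, hb⟩ : ∃ b, a + 3 - t = b := ⟨_, rfl⟩
      rw [hb] at h1b hbI
      have p1 := IsPathList.arc (i := 0) (m := 1) hwadj
        ((hwinj 0).mono (Set.Ico_subset_Ico (by omega) (by omega)))
      have p2 := IsPathList.arc (i := b) (m := a - b) hwadj
        ((hwinj 0).mono (Set.Ico_subset_Ico (by omega) (by omega)))
      rw [show 0 + 1 = 1 by omega] at p1
      rw [show b + (a - b) = a by omega] at p2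
      have p := p1.append p2 h1b (by
        intro x hx hx'
        rw [mem_arc] at hx hx'
        obtain ⟨k, hk1, hk2, rfl⟩ := hx
        obtain ⟨k', hk1', hk2', h⟩ := hx'
        have := hwinj 0 ⟨by omega, by omega⟩ ⟨by omega, by omega⟩ h
        omega)
      have hlen : ((List.range' 0 (1 + 1)).map w).length +
        ((List.range' b (a - b + 1)).map w).length = t := by simp; omega
      rw [← hlen, ← List.length_append]
      refine p.hasCycle h0a.symm (by rw [List.length_append, hlen]; exact ht) ?_
      intro x hx
      rw [List.mem_append, mem_arc, mem_arc] at hx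
      rcases hx with ⟨k, -, -, rfl⟩ | ⟨k, -, -, rfl⟩ <;> exact hwC k
  have hsub : I.image φ ∪ J ⊆ Finset.Ico 2 c := by
    refine Finset.union_subset ?_ (Finset.filter_subset _ _)
    intro b hb
    obtain ⟨a, haI, rfl⟩ := Finset.mem_image.1 hb
    have := Finset.mem_Ico.1 (Finset.mem_filter.1 haI).1
    rw [Finset.mem_Ico]
    simp only [φ]
    split_ifs <;> omega
  have hcard := Finset.card_le_card hsub
  rw [Finset.card_union_of_disjoint hdisj, Finset.card_image_of_injOn hφinj,
    Nat.card_Ico] at hcard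
  rw [← hw0, ← hw1]
  omega

/-- Bondy's theorem on pancyclic Hamiltonian graphs. -/
lemma two_mul_degSum_le (hv : Function.Injective v) (ha : ∀ i, G.Adj (v i) (v (i + 1)))
    {t : ℕ} (ht : 3 ≤ t) (htc : t < c) (hno : ¬ HasCycle G (univ.image v) t) :
    2 * degSum G (univ.image v) ≤ c * c := by
  unfold degSum
  rw [sum_image_cyclic hv]
  calc _ ≤ ∑ i : ZMod c, c :=
        Finset.sum_le_sum fun i _ => degIn_add_degIn_le hv ha ht htc hno i
    _ = c * c := by simp [ZMod.card]

/-- The ends of an edge of a Hamiltonian cycle with large degree sum are joined by paths of all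
small lengths. -/
lemma exists_path_of_degIn (hv : Function.Injective v) (ha : ∀ i, G.Adj (v i) (v (i + 1)))
    (hc : 2 ≤ c) {g p : ℕ} {i : ZMod c}
    (hg : c + g ≤ degIn G (univ.image v) (v i) + degIn G (univ.image v) (v (i + 1)))
    (hp1 : 1 ≤ p) (hpg : p ≤ g + 1) :
    ∃ l : List V, IsPathList G l (v (i + 1)) (v i) ∧ l.length = p + 1 ∧
      ∀ z ∈ l, z ∈ univ.image v := by
  have hC : ∀ k, v k ∈ univ.image v := fun k => Finset.mem_image_of_mem _ (Finset.mem_univ _)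
  rcases Nat.lt_or_ge p 2 with hp | hp
  · obtain rfl : p = 1 := by omega
    refine ⟨[v (i + 1)] ++ [v i], (IsPathList.singleton _).append (IsPathList.singleton _)
      (ha i).symm (by simpa using (ha i).ne'), rfl, ?_⟩
    intro z hz
    simp only [List.cons_append, List.nil_append, List.mem_cons, List.not_mem_nil, or_false] at hz
    rcases hz with rfl | rfl <;> exact hC _
  set w : ℕ → V := fun k => v (i + 1 + k) with hw
  have hwadj : ∀ k, G.Adj (w k) (w (k + 1)) := fun k => adj_cyclic ha (i + 1) k
  have hwinj : Set.InjOn w (Set.Ico 0 (0 + c)) := injOn_cyclic hv (i + 1) 0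
  have hw0 : w 0 = v (i + 1) := by simp [hw]
  have hwc : w (c - 1) = v i := by
    simp only [hw]
    rw [Nat.cast_sub (by omega)]
    simp
  let I : Finset ℕ := {k ∈ Finset.Ico 1 (c - 1) | G.Adj (v i) (w k)}
  let J : Finset ℕ := {k ∈ Finset.Ico 1 (c - 1) | G.Adj (v (i + 1)) (w k)}
  have hI : degIn G (univ.image v) (v i) ≤ #I + 1 := by
    rw [degIn_cyclic hv (i + 1) 0]
    refine le_trans (Finset.card_le_card (t := insert 0 I) fun k hk => ?_)
      (Finset.card_insert_le _ _)
    rw [Finset.mem_filter, Finset.mem_Ico] at hk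
    rw [Finset.mem_insert, Finset.mem_filter, Finset.mem_Ico]
    have : k ≠ c - 1 := by
      rintro rfl
      have := hk.2
      change G.Adj (v i) (w (c - 1)) at this
      rw [hwc] at this
      exact G.loopless.irrefl _ this
    by_cases h1 : k = 0
    · exact Or.inl h1
    · exact Or.inr ⟨⟨by omega, by omega⟩, hk.2⟩
  have hJ : degIn G (univ.image v) (v (i + 1)) ≤ #J + 1 := by
    rw [degIn_cyclic hv (i + 1) 0]
    refine le_trans (Finset.card_le_card (t := insert (c - 1) J) fun k hk => ?_)
      (Finset.card_insert_le _ _)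
    rw [Finset.mem_filter, Finset.mem_Ico] at hk
    rw [Finset.mem_insert, Finset.mem_filter, Finset.mem_Ico]
    have : k ≠ 0 := by
      rintro rfl
      have := hk.2
      change G.Adj (v (i + 1)) (w 0) at this
      rw [hw0] at this
      exact G.loopless.irrefl _ this
    by_cases h1 : k = c - 1
    · exact Or.inl h1
    · exact Or.inr ⟨⟨by omega, by omega⟩, hk.2⟩
  -- The path sought goes from `v (i + 1)` to an arc of p - 1 vertices and then to `v i`. If no arc
  -- fits, the shifted `J` and `I` are disjoint in an interval of c + p - 4 integers, while |I| +
  -- |J| ≥ c + g - 2.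
  obtain ⟨a, haJ, haI⟩ : ∃ a ∈ J, a + (p - 2) ∈ I := by
    by_contra! hcon
    have hdisj : Disjoint (J.image (· + (p - 2))) I := by
      rw [Finset.disjoint_left]
      intro x hx hx'
      obtain ⟨s, hs, rfl⟩ := Finset.mem_image.1 hx
      exact hcon s hs hx'
    have hsub : J.image (· + (p - 2)) ∪ I ⊆ Finset.Ico 1 (c - 1 + (p - 2)) := by
      intro x hx
      rw [Finset.mem_Ico]
      rcases Finset.mem_union.1 hx with hx | hx
      · obtain ⟨s, hs, rfl⟩ := Finset.mem_image.1 hx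
        have := Finset.mem_Ico.1 (Finset.mem_filter.1 hs).1
        omega
      · have := Finset.mem_Ico.1 (Finset.mem_filter.1 hx).1
        omega
    have hcard := Finset.card_le_card hsub
    rw [Finset.card_union_of_disjoint hdisj,
      Finset.card_image_of_injective _ (add_left_injective _), Nat.card_Ico] at hcard
    omega
  obtain ⟨haJ, hya⟩ := Finset.mem_filter.1 haJ
  obtain ⟨haI, hxb⟩ := Finset.mem_filter.1 haI
  rw [Finset.mem_Ico] at haJ haI
  have parc := IsPathList.arc (i := a) (m := p - 2) hwadj
    (hwinj.mono (Set.Ico_subset_Ico (by omega) (by omega)))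
  have p1 := (IsPathList.singleton (G := G) (w 0)).append parc (hw0 ▸ hya) (by
    intro x hx hx'
    rw [List.mem_singleton] at hx
    rw [mem_arc] at hx'
    obtain ⟨k, hk1, hk2, h⟩ := hx'
    have := hwinj ⟨by omega, by omega⟩ ⟨by omega, by omega⟩ (h.trans hx)
    omega)
  have p2 := p1.append (IsPathList.singleton (G := G) (w (c - 1))) (hwc ▸ hxb.symm) (by
    intro x hx hx'
    rw [List.mem_singleton] at hx'
    subst hx'
    rw [List.mem_append, List.mem_singleton, mem_arc] at hx
    rcases hx with h | ⟨k, hk1, hk2, h⟩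
    · have := hwinj ⟨by omega, by omega⟩ ⟨by omega, by omega⟩ h
      omega
    · have := hwinj ⟨by omega, by omega⟩ ⟨by omega, by omega⟩ h
      omega)
  rw [hw0, hwc] at p2
  refine ⟨_, p2, ?_, ?_⟩
  · simp; omega
  · intro z hz
    rw [List.mem_append, List.mem_append, mem_arc, List.mem_singleton, List.mem_singleton] at hz
    rcases hz with (rfl | ⟨k, -, -, rfl⟩) | rfl <;> exact hC _

end CyclicSequence

/-! ### Cycles of all lengths up to the circumference -/

lemma eq_univ_of_add_one_mem {c : ℕ} [NeZero c] {A : Finset (ZMod c)} (hA : A.Nonempty)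
    (h : ∀ a ∈ A, a + 1 ∈ A) (z : ZMod c) : z ∈ A := by
  obtain ⟨a, ha⟩ := hA
  have key : ∀ k : ℕ, a + k ∈ A := by
    intro k
    induction k with
    | zero => simpa using ha
    | succ k ih =>
      have := h _ ih
      rwa [add_assoc, ← Nat.cast_succ] at this
  have := key (z - a).val
  rw [ZMod.natCast_rightInverse] at this
  simpa using this

/-- If `B` avoids `g + 1` consecutive translates of `A`, then `A` and `B` are small. -/
lemma card_add_card_add_le {c : ℕ} [NeZero c] {A B : Finset (ZMod c)} (hA : A.Nonempty)
    (hB : B.Nonempty) (q g : ℕ) (h : ∀ i ≤ g, ∀ a ∈ A, a + (q + i : ℕ) ∉ B) :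
    #A + #B + g ≤ c := by
  let T : ℕ → Finset (ZMod c) := fun k => {z | ∃ a ∈ A, ∃ i ≤ k, z = a + (q + i : ℕ)}
  have hT : ∀ k, k ≤ g → #A + k ≤ #(T k) ∧ Disjoint (T k) B := by
    intro k
    induction k with
    | zero =>
      intro _
      refine ⟨?_, ?_⟩
      · rw [add_zero, ← Finset.card_image_of_injective A (add_left_injective ((q + 0 : ℕ) : ZMod c))]
        refine Finset.card_le_card fun z hz => ?_
        obtain ⟨a, ha, rfl⟩ := Finset.mem_image.1 hz
        exact Finset.mem_filter.2 ⟨Finset.mem_univ _, a, ha, 0, le_rfl, rfl⟩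
      · rw [Finset.disjoint_left]
        intro z hz
        obtain ⟨a, ha, i, hi, rfl⟩ := (Finset.mem_filter.1 hz).2
        exact h i (by omega) a ha
    | succ k ih =>
      intro hk
      obtain ⟨h1, h2⟩ := ih (by omega)
      have hdis : Disjoint (T (k + 1)) B := by
        rw [Finset.disjoint_left]
        intro z hz
        obtain ⟨a, ha, i, hi, rfl⟩ := (Finset.mem_filter.1 hz).2
        exact h i (by omega) a ha
      refine ⟨?_, hdis⟩
      -- `T (k + 1)` contains `T k` and `T k + 1`. If it equalled `T k`, that set would be closed
      -- under adding 1 and hence everything, but it misses the nonempty `B`.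
      have hss : T k ⊂ T (k + 1) := by
        refine (Finset.ssubset_iff_subset_ne).2 ⟨?_, ?_⟩
        · intro z hz
          obtain ⟨a, ha, i, hi, rfl⟩ := (Finset.mem_filter.1 hz).2
          exact Finset.mem_filter.2 ⟨Finset.mem_univ _, a, ha, i, by omega, rfl⟩
        · intro heq
          obtain ⟨b, hb⟩ := hB
          refine Finset.disjoint_left.1 hdis (eq_univ_of_add_one_mem ?_ ?_ b) hb
          · obtain ⟨a, ha⟩ := hA
            exact ⟨_, Finset.mem_filter.2 ⟨Finset.mem_univ _, a, ha, 0, by omega, rfl⟩⟩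
          · intro z hz
            rw [← heq] at hz
            obtain ⟨a, ha, i, hi, rfl⟩ := (Finset.mem_filter.1 hz).2
            refine Finset.mem_filter.2 ⟨Finset.mem_univ _, a, ha, i + 1, by omega, ?_⟩
            push_cast; ring
      have := Finset.card_lt_card hss
      omega
  obtain ⟨h1, h2⟩ := hT g le_rfl
  have := Finset.card_le_univ (T g ∪ B)
  rw [Finset.card_union_of_disjoint h2, ZMod.card] at this
  omega

/-- A vertex outside a cycle with more than half of the cycle as neighbours closes cycles of all
lengths. -/
lemma two_mul_degIn_le_of_notMem {c : ℕ} [NeZero c] {v : ZMod c → V} (hv : Function.Injective v)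
    (ha : ∀ i, G.Adj (v i) (v (i + 1))) {S : Finset V} (hvS : ∀ i, v i ∈ S) {t : ℕ} (ht : 3 ≤ t)
    (htc : t < c) (hno : ¬ HasCycle G S t) {x : V} (hxS : x ∈ S) (hx : ∀ i, v i ≠ x) :
    2 * degIn G (univ.image v) x ≤ c := by
  rw [degIn_image_eq hv]
  set A : Finset (ZMod c) := {i | G.Adj x (v i)} with hA
  have hdisj : Disjoint (A.image (· + ((t - 2 : ℕ) : ZMod c))) A := by
    rw [Finset.disjoint_left]
    intro z hz hz'
    obtain ⟨i, hi, rfl⟩ := Finset.mem_image.1 hz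
    rw [hA, Finset.mem_filter] at hi hz'
    apply hno
    have := hasCycle_of_path_of_arc hv ha hvS (IsPathList.singleton (G := G) x)
      (by simpa using hxS) (by simpa using hx) (j := i) (q := t - 2) (by omega) hi.2 hz'.2
      (by simp; omega)
    rwa [List.length_singleton, show 1 + (t - 2 + 1) = t by omega] at this
  have h := Finset.card_le_univ (A.image (· + ((t - 2 : ℕ) : ZMod c)) ∪ A)
  rw [Finset.card_union_of_disjoint hdisj, Finset.card_image_of_injective _ (add_left_injective _),
    ZMod.card] at h
  omega

/-- A graph with more than `n ^ 2 / 4` edges has cycles of all lengths from `3` up to its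
circumference. -/
theorem hasCycle_of_le {S : Finset V} (hS : #S * #S < 2 * degSum G S) {t c : ℕ} (ht : 3 ≤ t)
    (htc : t ≤ c) (hc : HasCycle G S c) : HasCycle G S t := by
  induction hN : #S using Nat.strong_induction_on generalizing S c with
  | _ N ih =>
  by_contra hno
  -- Deleting a vertex of degree below |S|/2 keeps the edge density hypothesis, so induction applies
  -- if a cycle of length at least t survives.
  have hlow : ∀ v ∈ S, 2 * degIn G S v < #S → ∀ c', t ≤ c' → ¬ HasCycle G (S.erase v) c' := by
    intro v hv hdv c' hc' hcyc
    have hpos : 0 < #S := Finset.card_pos.2 ⟨v, hv⟩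
    refine hno ((ih (#(S.erase v)) ?_ ?_ hc' hcyc rfl).mono (Finset.erase_subset _ _))
    · rw [Finset.card_erase_of_mem hv]; omega
    · rw [Finset.card_erase_of_mem hv]
      have h1 := degSum_erase (G := G) hv
      obtain ⟨m, hm⟩ : ∃ m, #S = m + 1 := ⟨#S - 1, by omega⟩
      rw [hm] at hS hdv ⊢
      simp only [Nat.add_sub_cancel]
      nlinarith
  have htc' : t < c := lt_of_le_of_ne htc fun h => hno (h ▸ hc)
  obtain ⟨h3, v, hv, hvS, hva⟩ := hc
  have : NeZero c := ⟨by omega⟩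
  set C : Finset V := univ.image v with hC
  have hCS : C ⊆ S := fun x hx => by
    obtain ⟨i, -, rfl⟩ := Finset.mem_image.1 hx; exact hvS i
  have hvC : ∀ i, v i ∈ C := fun i => Finset.mem_image_of_mem _ (Finset.mem_univ _)
  have hCc : #C = c := card_image_cyclic hv
  set H : Finset V := S \ C with hH
  have hdisj : Disjoint C H := Finset.disjoint_sdiff
  have hCH : C ∪ H = S := Finset.union_sdiff_of_subset hCS
  have hHS : H ⊆ S := Finset.sdiff_subset
  have hcard : #S = c + #H := by rw [← hCH, Finset.card_union_of_disjoint hdisj, hCc]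
  have hvH : ∀ x ∈ H, ∀ i, v i ≠ x := fun x hx i h =>
    (Finset.mem_sdiff.1 hx).2 (h ▸ hvC i)
  have hdegS : ∀ x ∈ H, #S ≤ 2 * degIn G S x := by
    intro x hx
    by_contra! hlt
    refine hlow x (hHS hx) hlt c htc ⟨h3, v, hv, fun i => ?_, hva⟩
    exact Finset.mem_erase.2 ⟨hvH x hx i, hvS i⟩
  have hdegC : ∀ x ∈ H, 2 * degIn G C x ≤ c := fun x hx =>
    two_mul_degIn_le_of_notMem hv hva hvS ht htc' hno (hHS hx) (hvH x hx)
  have hsplit : ∀ x, degIn G S x = degIn G C x + degIn G H x := fun x => by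
    rw [← hCH, degIn_union hdisj]
  have hdegH : ∀ x ∈ H, #H ≤ 2 * degIn G H x := by
    intro x hx
    have h1 := hdegS x hx
    have h2 := hdegC x hx
    have h3 := hsplit x
    omega
  have hWC : 2 * degSum G C ≤ c * c :=
    two_mul_degSum_le hv hva ht htc' fun h => hno (h.mono hCS)
  have hWS : degSum G S = degSum G C + degSum G H + 2 * ∑ x ∈ H, degIn G C x := by
    rw [← hCH, degSum_union hdisj]
  have hsumC : 2 * ∑ x ∈ H, degIn G C x ≤ #H * c := by
    rw [Finset.mul_sum]
    calc _ ≤ ∑ x ∈ H, c := Finset.sum_le_sum hdegC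
      _ = _ := by simp
  -- The bounds on edges inside `C` and between `C` and `H` force `H` to satisfy the same density
  -- hypothesis. By Dirac it is Hamiltonian, and by Bondy it would have a `t`-cycle unless m < t.
  have hWH : #H * #H < 2 * degSum G H := by
    rw [hcard] at hS
    nlinarith
  have hH3 : 3 ≤ #H := by
    have h1 := degSum_le (G := G) H
    by_contra! hlt
    interval_cases #H <;> omega
  have hham := hasCycle_card_of_minDegree hH3 hdegH
  obtain ⟨m, hm⟩ : ∃ m, #H = m := ⟨_, rfl⟩
  rw [hm] at hham hH3 hWH hsumC hcard hdegH
  obtain ⟨-, h, hh, hhH, hha⟩ := hham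
  have : NeZero m := ⟨by omega⟩
  have himH : univ.image h = H := by
    refine Finset.eq_of_subset_of_card_le (fun x hx => ?_) ?_
    · obtain ⟨i, -, rfl⟩ := Finset.mem_image.1 hx; exact hhH i
    · rw [card_image_cyclic hh, hm]
  have hmt : m < t := by
    by_contra! hle
    rcases Nat.lt_or_ge t m with hlt | hge
    · have := two_mul_degSum_le hh hha ht hlt
        (fun hc => hno (hc.mono (by rw [himH]; exact hHS)))
      rw [himH] at this
      omega
    · obtain rfl : t = m := le_antisymm hle hge
      exact hno ⟨ht, h, hh, fun i => hHS (hhH i), hha⟩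
  have hpos : ∀ x ∈ H, 0 < degIn G C x := by
    intro x hx
    have h1 := hdegS x hx
    have h2 := hsplit x
    have h3 := degIn_le_card_sub_one (G := G) hx
    omega
  -- If the degree sum of the pair inside `H` is m + g, the two are joined in `H` by paths on 2,
  -- ..., g + 2 vertices. None of these may be completed by an arc of `C` to a `t`-cycle, so their
  -- neighbourhoods on `C` avoid g + 1 consecutive shifts and have total size at most c - g.
  have hpair : ∀ i : ZMod m, degIn G S (h i) + degIn G S (h (i + 1)) ≤ #S := by
    intro i
    have hd1 := hdegH _ (hhH i)
    have hd2 := hdegH _ (hhH (i + 1))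
    obtain ⟨g, hg⟩ : ∃ g, degIn G H (h i) + degIn G H (h (i + 1)) = m + g :=
      ⟨degIn G H (h i) + degIn G H (h (i + 1)) - m, by omega⟩
    have hgm : g + 2 ≤ m := by
      have h1 := degIn_le_card_sub_one (G := G) (hhH i)
      have h2 := degIn_le_card_sub_one (G := G) (hhH (i + 1))
      omega
    have hcrd := card_add_card_add_le (A := {j : ZMod c | G.Adj (h i) (v j)})
      (B := {j : ZMod c | G.Adj (h (i + 1)) (v j)})
      (Finset.card_pos.1 (by rw [← degIn_image_eq hv]; exact hpos _ (hhH i)))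
      (Finset.card_pos.1 (by rw [← degIn_image_eq hv]; exact hpos _ (hhH (i + 1))))
      (t - 3 - g) g (by
        intro k hk a ha hb
        have ha' := (Finset.mem_filter.1 ha).2
        have hb' := (Finset.mem_filter.1 hb).2
        obtain ⟨l, hl, hlen, hlH⟩ := exists_path_of_degIn (g := g) (p := g + 1 - k) (i := i)
          hh hha (by omega) (by rw [himH]; omega) (by omega) (by omega)
        rw [himH] at hlH
        apply hno
        have := hasCycle_of_path_of_arc hv hva hvS hl (fun z hz => hHS (hlH z hz))
          (fun z hz => hvH z (hlH z hz)) (j := a) (q := t - 3 - g + k) (by omega) ha' hb'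
          (by omega)
        rwa [hlen, show g + 1 - k + 1 + (t - 3 - g + k + 1) = t by omega] at this)
    rw [← degIn_image_eq hv, ← degIn_image_eq hv, ← hC] at hcrd
    have h1 := hsplit (h i)
    have h2 := hsplit (h (i + 1))
    omega
  have hsum : 2 * ∑ x ∈ H, degIn G S x ≤ m * #S := by
    rw [← himH, sum_image_cyclic hh]
    calc _ ≤ ∑ i : ZMod m, #S := Finset.sum_le_sum fun i _ => hpair i
      _ = _ := by simp [ZMod.card]
  have hsum' : ∑ x ∈ H, degIn G S x = ∑ x ∈ H, degIn G C x + degSum G H := by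
    unfold degSum
    rw [← Finset.sum_add_distrib]
    exact Finset.sum_congr rfl fun x _ => hsplit x
  -- Altogether 2 `degSum S` ≤ c² + m(c + m) + mc = (c + m)², the three terms bounding `C`, the
  -- degrees of `H` in `S`, and the edges between `C` and `H` counted from the side of `C`.
  rw [hcard] at hS hsum
  nlinarith

/-! ### Defect and the Erdős–Gallai bound -/

/-- How much `2 e(S)` falls short of `c |S|`. -/
noncomputable def defect (G : SimpleGraph V) (c : ℕ) (S : Finset V) : ℤ :=
  (c : ℤ) * #S - degSum G S

lemma defect_erase_le {c : ℕ} {S : Finset V} {v : V} (hv : v ∈ S) (h : 2 * degIn G S v ≤ c) :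
    defect G c (S.erase v) ≤ defect G c S := by
  unfold defect
  have h1 := degSum_erase (G := G) hv
  have h2 := Finset.card_erase_add_one hv
  rw [h1, ← h2]
  push_cast
  have h3 : (2 * degIn G S v : ℤ) ≤ c := by exact_mod_cast h
  linarith

lemma sum_degIn_sdiff_le {S X : Finset V} {b : V}
    (hX : ∀ y ∈ X, ∀ z ∈ S, G.Adj y z → z ∈ insert b X) :
    ∑ x ∈ X, degIn G (S \ X) x ≤ #X := by
  calc _ ≤ ∑ x ∈ X, 1 := Finset.sum_le_sum fun x hx => by
        refine (Finset.card_le_card (t := {b}) fun z hz => ?_).trans (Finset.card_singleton b).le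
        rw [Finset.mem_filter, Finset.mem_sdiff] at hz
        have := hX x hx z hz.1.1 hz.2
        rw [Finset.mem_insert] at this
        exact Finset.mem_singleton.2 (this.resolve_right hz.1.2)
    _ = _ := by simp

/-- Each vertex of X has at most one neighbour in S outside X, namely b. The edges leaving X thus
contribute at most 2|X| to the degree sum, whence c - 2 in place of c. -/
lemma defect_sdiff_le {c : ℕ} {S X : Finset V} {b : V} (hXS : X ⊆ S)
    (hX : ∀ y ∈ X, ∀ z ∈ S, G.Adj y z → z ∈ insert b X) :
    defect G c (S \ X) + ((c - 2) * #X - degSum G X) ≤ defect G c S := by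
  unfold defect
  have h1 := degSum_union (G := G) (Finset.disjoint_sdiff (s := X) (t := S))
  rw [Finset.union_sdiff_of_subset hXS, sum_degIn_comm] at h1
  have h2 := sum_degIn_sdiff_le hX
  have h3 : #S = #(S \ X) + #X := (Finset.card_sdiff_add_card_eq_card hXS).symm
  have h2' : ((∑ x ∈ X, degIn G (S \ X) x : ℕ) : ℤ) ≤ #X := by exact_mod_cast h2
  rw [h1, h3]
  push_cast at h2' ⊢
  linarith

lemma degSum_le_int (S : Finset V) : (degSum G S : ℤ) ≤ #S * (#S - 1) := by
  have h := degSum_le (G := G) S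
  rcases Nat.eq_zero_or_pos #S with h0 | h0
  · rw [h0] at h ⊢; simp at h ⊢; omega
  · have : ((#S * (#S - 1) : ℕ) : ℤ) = #S * (#S - 1) := by
      rw [Nat.cast_mul, Nat.cast_sub h0]; simp
    rw [← this]; exact_mod_cast h

/-- Deleting vertices of degree at most `c / 2` one at a time, without increasing the defect. -/
lemma exists_core (c r : ℕ) (S : Finset V) (hr : r ≤ #S) :
    ∃ S₁ ⊆ S, (#S₁ = r ∨ ∀ v ∈ S₁, c < 2 * degIn G S₁ v) ∧ r ≤ #S₁ ∧
      ∀ k, #S₁ ≤ k → k ≤ #S → ∃ U, S₁ ⊆ U ∧ U ⊆ S ∧ #U = k ∧ defect G c U ≤ defect G c S := by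
  induction hN : #S using Nat.strong_induction_on generalizing S with
  | _ N ih =>
  by_cases hdone : #S = r ∨ ∀ v ∈ S, c < 2 * degIn G S v
  · refine ⟨S, Finset.Subset.refl _, hdone, hr, fun k h1 h2 => ?_⟩
    exact ⟨S, Finset.Subset.refl _, Finset.Subset.refl _, by omega, le_rfl⟩
  · push Not at hdone
    obtain ⟨hne, v, hv, hdv⟩ := hdone
    have hcard := Finset.card_erase_add_one hv
    obtain ⟨S₁, hS₁, hcore, hrS₁, hU⟩ := ih #(S.erase v) (by omega) (S.erase v) (by omega) rfl
    refine ⟨S₁, hS₁.trans (Finset.erase_subset _ _), hcore, hrS₁, fun k h1 h2 => ?_⟩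
    rcases Nat.lt_or_ge k #S with hk | hk
    · obtain ⟨U, hU1, hU2, hU3, hU4⟩ := hU k h1 (by omega)
      exact ⟨U, hU1, hU2.trans (Finset.erase_subset _ _), hU3, hU4.trans (defect_erase_le hv hdv)⟩
    · exact ⟨S, hS₁.trans (Finset.erase_subset _ _), Finset.Subset.refl _, by omega, le_rfl⟩

/-- The data provided by `exists_end_block` for a set of minimum degree more than `c / 2`. -/
lemma exists_dense_end {c : ℕ} (hc : 2 ≤ c) {S : Finset V} (hS : S.Nonempty)
    (hcyc : ∀ t, HasCycle G S t → t ≤ c) (hdeg : ∀ v ∈ S, c < 2 * degIn G S v) :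
    ∃ X ⊆ S, c < 2 * #X ∧ #X + 1 ≤ c ∧ (∀ x ∈ X, c ≤ 2 * degIn G X x + 1) ∧
      ∑ x ∈ X, degIn G (S \ X) x ≤ #X ∧
      defect G c (S \ X) + ((c - 2) * #X - degSum G X) ≤ defect G c S := by
  obtain ⟨X, hXS, b, hb, hbX, hdX, hXc, hX⟩ := exists_end_block (d := c / 2 + 1) hS (by omega)
    (fun v hv => by have := hdeg v hv; omega) hcyc (by omega)
  refine ⟨X, hXS, by omega, hXc, fun x hx => ?_, sum_degIn_sdiff_le hX, defect_sdiff_le hXS hX⟩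
  have h1 : degIn G S x ≤ degIn G X x + 1 := by
    refine le_trans (Finset.card_le_card (t := insert b {u ∈ X | G.Adj x u}) fun z hz => ?_)
      (Finset.card_insert_le _ _)
    rw [Finset.mem_filter] at hz
    have := hX x hx z hz.1 hz.2
    rw [Finset.mem_insert] at this ⊢
    exact this.imp_right fun h => Finset.mem_filter.2 ⟨h, hz.2⟩
  have h2 := hdeg x (hXS hx)
  omega

/-- The Erdős–Gallai bound: a graph without cycles longer than `c` has at most `c n / 2` edges. -/
lemma defect_nonneg {c : ℕ} (hc : 2 ≤ c) {S : Finset V} (hcyc : ∀ t, HasCycle G S t → t ≤ c) :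
    0 ≤ defect G c S := by
  induction hN : #S using Nat.strong_induction_on generalizing S with
  | _ N ih =>
  rcases S.eq_empty_or_nonempty with rfl | hS
  · simp [defect, degSum]
  by_cases hdeg : ∀ v ∈ S, c < 2 * degIn G S v
  · obtain ⟨X, hXS, hcX, hXc, -, -, hdef⟩ := exists_dense_end hc hS hcyc hdeg
    have hcard := Finset.card_sdiff_add_card_eq_card hXS
    have h1 := ih #(S \ X) (by omega) (S := S \ X)
      (fun t ht => hcyc t (ht.mono Finset.sdiff_subset)) rfl
    -- Splitting off `X` lowers the defect by at least (c - 1 - |X|)|X|, which is nonnegative.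
    have h2 := degSum_le_int (G := G) X
    have h3 : (#X : ℤ) + 1 ≤ c := by exact_mod_cast hXc
    nlinarith [Int.natCast_nonneg #X]
  · push Not at hdeg
    obtain ⟨v, hv, hdv⟩ := hdeg
    have hcard := Finset.card_erase_add_one hv
    exact (ih #(S.erase v) (by omega) (S := S.erase v)
      (fun t ht => hcyc t (ht.mono (Finset.erase_subset _ _))) rfl).trans (defect_erase_le hv hdv)

/-! ### Almost complete sets and absorption -/

/-- An almost complete set of vertices, together with a few vertices with many neighbours in it,
is Hamiltonian connected. -/
lemma exists_hamiltonPath_of_dense {c : ℕ} {n ε : ℝ} (hε : 1 / 2 < ε) (hεn : 100000 * ε < n)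
    (hnc : n < 2 * c) {A Y : Finset V} (hAY : Disjoint A Y) (hAc : #A + 1 ≤ c)
    (hAl : (c : ℝ) - 1 - 4 * ε ≤ #A) (hsum : ((c : ℝ) - 2) * #A - degSum G A ≤ ε * n)
    (hA : ∀ x ∈ A, c ≤ 2 * degIn G A x + 1) (hY : ∀ y ∈ Y, c ≤ 5 * degIn G A y)
    (hYc : (#Y : ℝ) ≤ 42 * ε) {a b : V} (ha : a ∈ A ∪ Y) (hb : b ∈ A ∪ Y) (hab : a ≠ b) :
    ∃ l : List V, l.toFinset = A ∪ Y ∧ IsPathList G l a b := by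
  set T : Finset V := {x ∈ A | 9 * c ≤ 10 * degIn G A x} with hT
  have hTA : T ⊆ A := Finset.filter_subset _ _
  have hcard : (#(A \ T) : ℝ) + #T = #A := by
    exact_mod_cast Finset.card_sdiff_add_card_eq_card hTA
  have hAc' : (#A : ℝ) + 1 ≤ c := by exact_mod_cast hAc
  have hdeg : (degSum G A : ℝ) ≤ #(A \ T) * (0.9 * c) + #T * (c - 2) := by
    unfold degSum
    rw [← Finset.sum_sdiff hTA]
    push_cast
    refine add_le_add ?_ ?_
    · rw [← nsmul_eq_mul]
      refine Finset.sum_le_card_nsmul _ _ _ fun x hx => ?_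
      rw [Finset.mem_sdiff, hT, Finset.mem_filter] at hx
      have h1 : 10 * degIn G A x < 9 * c := by
        by_contra! h
        exact hx.2 ⟨hx.1, h⟩
      have h2 : (10 * degIn G A x : ℝ) < 9 * c := by exact_mod_cast h1
      linarith
    · rw [← nsmul_eq_mul]
      refine Finset.sum_le_card_nsmul _ _ _ fun x hx => ?_
      have h1 := degIn_le_card_sub_one (G := G) (hTA hx)
      have h2 : degIn G A x + 2 ≤ c := by
        have := Finset.card_pos.2 ⟨x, hTA hx⟩
        omega
      have h3 : (degIn G A x + 2 : ℝ) ≤ c := by exact_mod_cast h2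
      linarith
  -- Every vertex outside `T` uses up at least 0.1c - 2 of the slack εn, and 0.1c - 2 ≥ n/23. The
  -- degree condition then holds since 0.9c + 0.2c exceeds c + 42ε.
  have hsmall : (#(A \ T) : ℝ) ≤ 23 * ε := by
    have h1 : (#(A \ T) : ℝ) * (0.1 * c - 2) ≤ ε * n := by
      rw [← hcard] at hsum
      linarith
    have h2 : ε * n ≤ ε * (23 * (0.1 * c - 2)) :=
      mul_le_mul_of_nonneg_left (by linarith) (by linarith)
    have h3 : (0 : ℝ) < 0.1 * c - 2 := by linarith
    exact le_of_mul_le_mul_right (h1.trans (h2.trans_eq (by ring))) h3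
  have hunion : (#(A ∪ Y) : ℝ) = #A + #Y := by
    exact_mod_cast Finset.card_union_of_disjoint hAY
  have hle : ∀ x, degIn G A x ≤ degIn G (A ∪ Y) x := degIn_mono Finset.subset_union_left
  refine exists_hamiltonPath (T := T) (hTA.trans Finset.subset_union_left) ?_ ha hb hab G ?_
  · have : (#(A ∪ Y) : ℝ) + 1 ≤ 2 * #T := by linarith
    exact_mod_cast this
  · intro x hx y hy _
    have h1 : (9 * c : ℝ) ≤ 10 * degIn G A x := by
      exact_mod_cast (Finset.mem_filter.1 hx).2
    have h2 : (c : ℝ) ≤ 5 * degIn G A y := by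
      rcases Finset.mem_union.1 hy with h | h
      · have h4 : (c : ℝ) ≤ 2 * degIn G A y + 1 := by exact_mod_cast hA y h
        linarith
      · exact_mod_cast hY y h
    have h3 : (degIn G A x : ℝ) ≤ degIn G (A ∪ Y) x := by exact_mod_cast hle x
    have h4 : (degIn G A y : ℝ) ≤ degIn G (A ∪ Y) y := by exact_mod_cast hle y
    have : (#(A ∪ Y) : ℝ) + 1 ≤ degIn G (A ∪ Y) x + degIn G (A ∪ Y) y := by linarith
    exact_mod_cast this

/-- An almost complete set of about `c` vertices cannot be followed by many vertices sending
about `c / 2` edges back, if there are no cycles longer than `c`. -/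
lemma false_of_single_dense_end {c : ℕ} {n ε : ℝ} (hε : 1 / 2 < ε) (hεn : 100000 * ε < n)
    (hnc : n < 2 * c) {S X U : Finset V} (hXS : X ⊆ S) (hSU : S ⊆ U)
    (hcyc : ∀ t, HasCycle G U t → t ≤ c) (hXc : #X + 1 ≤ c)
    (hXl : (c : ℝ) - 1 - 4 * ε ≤ #X) (hsum : ((c : ℝ) - 2) * #X - degSum G X ≤ ε * n)
    (hX : ∀ x ∈ X, c ≤ 2 * degIn G X x + 1) (hXS' : ∑ x ∈ X, degIn G (S \ X) x ≤ #X)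
    (hrest : (#(S \ X) : ℝ) ≤ 4 * ε) (hU₁ : 40 * ε ≤ #(U \ S)) (hU₂ : (#(U \ S) : ℝ) ≤ 42 * ε)
    (hdef : (defect G c U : ℝ) ≤ ε * n) : False := by
  set Z : Finset V := (S \ X) ∪ (U \ S) with hZ
  have hdSU : Disjoint (S \ X) (U \ S) :=
    Finset.disjoint_left.2 fun x hx hx' => (Finset.mem_sdiff.1 hx').2 (Finset.mem_sdiff.1 hx).1
  have hdXZ : Disjoint X Z := by
    rw [Finset.disjoint_left]
    intro x hx hx'
    rcases Finset.mem_union.1 hx' with h | h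
    · exact (Finset.mem_sdiff.1 h).2 hx
    · exact (Finset.mem_sdiff.1 h).2 (hXS hx)
  have hXZ : X ∪ Z = U := by
    rw [hZ, ← Finset.union_assoc, Finset.union_sdiff_of_subset hXS,
      Finset.union_sdiff_of_subset hSU]
  have hUcard : (#U : ℝ) = #X + #Z := by
    rw [← hXZ]; exact_mod_cast Finset.card_union_of_disjoint hdXZ
  have hZcard : (#Z : ℝ) = #(S \ X) + #(U \ S) := by
    exact_mod_cast Finset.card_union_of_disjoint hdSU
  have hdegU : (degSum G U : ℝ) = degSum G X + degSum G Z +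
      2 * (∑ x ∈ X, degIn G (S \ X) x + ∑ y ∈ U \ S, degIn G X y) := by
    have h := degSum_union (G := G) hdXZ
    rw [hXZ, hZ, Finset.sum_union hdSU, ← hZ, sum_degIn_comm (S \ X)] at h
    exact_mod_cast h
  have hdegX : (degSum G X : ℝ) ≤ #X * (#X - 1) := by
    exact_mod_cast degSum_le_int (G := G) X
  have hdegZ : (degSum G Z : ℝ) ≤ #Z * (#Z - 1) := by
    exact_mod_cast degSum_le_int (G := G) Z
  have hXS'' : (∑ x ∈ X, degIn G (S \ X) x : ℝ) ≤ #X := by exact_mod_cast hXS'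
  have hXc' : (#X : ℝ) + 1 ≤ c := by exact_mod_cast hXc
  have hdef' : (c : ℝ) * #U - degSum G U ≤ ε * n := by
    have : (defect G c U : ℝ) = c * #U - degSum G U := by unfold defect; push_cast; ring
    rw [← this]; exact hdef
  set Y : Finset V := {y ∈ U \ S | c ≤ 5 * degIn G X y} with hY
  have hYU : Y ⊆ U \ S := Finset.filter_subset _ _
  have hYcard : (#((U \ S) \ Y) : ℝ) + #Y = #(U \ S) := by
    exact_mod_cast Finset.card_sdiff_add_card_eq_card hYU
  have hsumY : (∑ y ∈ U \ S, degIn G X y : ℝ) ≤ #((U \ S) \ Y) * (0.2 * c) + #Y * c := by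
    rw [← Finset.sum_sdiff hYU]
    refine add_le_add ?_ ?_
    · rw [← nsmul_eq_mul]
      refine Finset.sum_le_card_nsmul _ _ _ fun x hx => ?_
      rw [Finset.mem_sdiff, hY, Finset.mem_filter] at hx
      have h1 : 5 * degIn G X x < c := by
        by_contra! h
        exact hx.2 ⟨hx.1, h⟩
      have h2 : (5 * degIn G X x : ℝ) < c := by exact_mod_cast h1
      linarith
    · rw [← nsmul_eq_mul]
      refine Finset.sum_le_card_nsmul _ _ _ fun x _ => ?_
      have h1 : (degIn G X x : ℝ) ≤ #X := by exact_mod_cast degIn_le_card (G := G) X x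
      linarith
  -- Inside `X`, together with its few edges to `S \ X`, the degree sum is at most c|X|, and `Z`
  -- spans at most |Z|². The small defect of `U` forces the remaining edges to come from `U \ S`.
  have hlow : (c : ℝ) * #Z - ε * n - #Z * #Z ≤ 2 * ∑ y ∈ U \ S, (degIn G X y : ℝ) := by
    have h1 : (#X : ℝ) * (#X - 1) ≤ #X * (c - 2) :=
      mul_le_mul_of_nonneg_left (by linarith) (Nat.cast_nonneg _)
    have h2 : (0 : ℝ) ≤ #Z := Nat.cast_nonneg _
    rw [hUcard, hdegU] at hdef'
    push_cast at hdef'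
    linarith
  have hZ46 : (#Z : ℝ) ≤ 46 * ε := by linarith
  have hZ0 : (0 : ℝ) ≤ #Z := Nat.cast_nonneg _
  have hZsq : (#Z : ℝ) * #Z ≤ 0.022 * (ε * n) := by
    have h1 : (#Z : ℝ) * #Z ≤ (46 * ε) * (46 * ε) := mul_le_mul hZ46 hZ46 hZ0 (by linarith)
    have h2 : ε * (100000 * ε) ≤ ε * n := mul_le_mul_of_nonneg_left hεn.le (by linarith)
    linarith
  -- The average degree into `X` over `U \ S` is near c/2, so a fixed share of these at least 40ε
  -- vertices reach c/5. The 10ε gained outweighs the 4ε + 1 by which |X| may fall short of c.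
  have hYbig : 10 * ε ≤ #Y := by
    have hc0 : (0 : ℝ) < c := by linarith
    have h1 : (c : ℝ) * #(U \ S) ≤ c * #Z :=
      mul_le_mul_of_nonneg_left (by rw [hZcard]; linarith [Nat.cast_nonneg (α := ℝ) #(S \ X)])
        hc0.le
    have h2 : ε * n ≤ ε * (2 * c) := mul_le_mul_of_nonneg_left hnc.le (by linarith)
    have h3 : (c : ℝ) * (40 * ε) ≤ c * #(U \ S) := mul_le_mul_of_nonneg_left hU₁ hc0.le
    have h4 : (#((U \ S) \ Y) : ℝ) = #(U \ S) - #Y := by linarith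
    rw [h4] at hsumY
    have h5 : c * (10 * ε) ≤ c * (#Y : ℝ) := by
      have h6 : 0 ≤ ε * c := mul_nonneg (by linarith) hc0.le
      linarith
    exact le_of_mul_le_mul_left h5 hc0
  have hdXY : Disjoint X Y := Finset.disjoint_left.2 fun x hx hx' =>
    (Finset.mem_sdiff.1 (hYU hx')).2 (hXS hx)
  have hYle : (#Y : ℝ) ≤ 42 * ε := by linarith [Nat.cast_nonneg (α := ℝ) #((U \ S) \ Y)]
  have hXpos : 0 < #X := by
    have : (0 : ℝ) < #X := by linarith
    exact_mod_cast this
  obtain ⟨a, ha⟩ := Finset.card_pos.1 hXpos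
  obtain ⟨b, hb⟩ : ∃ b, b ∈ ({u ∈ X | G.Adj a u} : Finset V) := by
    refine Finset.card_pos.1 ?_
    have h1 : (c : ℝ) ≤ 2 * degIn G X a + 1 := by exact_mod_cast hX a ha
    have h2 : (0 : ℝ) < degIn G X a := by linarith
    exact_mod_cast h2
  rw [Finset.mem_filter] at hb
  obtain ⟨l, hlS, hl⟩ := exists_hamiltonPath_of_dense hε hεn hnc hdXY hXc hXl hsum hX
    (fun y hy => (Finset.mem_filter.1 hy).2) hYle (Finset.mem_union_left Y ha)
    (Finset.mem_union_left Y hb.1) hb.2.ne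
  have hlen : (l.length : ℝ) = #X + #Y := by
    rw [← List.toFinset_card_of_nodup hl.nodup, hlS]
    exact_mod_cast Finset.card_union_of_disjoint hdXY
  have h3 : 3 ≤ l.length := by
    have : (3 : ℝ) ≤ l.length := by linarith
    exact_mod_cast this
  have := hcyc _ (hl.hasCycle hb.2.symm h3 (S := U) fun x hx => by
    have hx' : x ∈ X ∪ Y := hlS ▸ List.mem_toFinset.2 hx
    rcases Finset.mem_union.1 hx' with h | h
    · exact hSU (hXS h)
    · exact (Finset.mem_sdiff.1 (hYU h)).1)
  have : (l.length : ℝ) ≤ c := by exact_mod_cast this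
  linarith

/-! ### Linked sets and separation by a vertex -/

namespace IsPathList

variable {l m s r : List V} {a b c w : V}

/-- Joining two paths at a common end. -/
lemma glue (h₁ : IsPathList G l a b) (h₂ : IsPathList G (b :: m) b c) (hd : ∀ x ∈ l, x ∉ m) :
    IsPathList G (l ++ m) a c := by
  rcases eq_or_ne m [] with rfl | hm
  · have : b = c := by simpa using h₂.last
    subst this
    simpa using h₁
  · obtain ⟨x, y, hx, hy, hxy, -⟩ := IsPathList.exists_split (l₁ := [b]) h₂ (by simp) hm
    have : b = x := by simpa using hx.last
    subst this
    exact h₁.append hy hxy hd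

lemma segment_to (h : IsPathList G (s ++ w :: r) a b) : IsPathList G (s ++ [w]) a w := by
  have h' : IsPathList G ((s ++ [w]) ++ r) a b := by simpa using h
  refine ⟨h'.chain.left_of_append, (List.nodup_append.1 h'.nodup).1, ?_, by simp⟩
  have := h'.head
  rwa [List.head?_append_of_ne_nil _ (by simp)] at this

lemma segment_from (h : IsPathList G (s ++ w :: r) a b) : IsPathList G (w :: r) w b := by
  refine ⟨h.chain.right_of_append, (List.nodup_append.1 h.nodup).2.1, rfl, ?_⟩
  have := h.last
  rwa [List.getLast?_append_of_ne_nil _ (by simp)] at this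

lemma disjoint_of_append (h : IsPathList G (s ++ r) a b) : ∀ x ∈ s, x ∉ r :=
  fun x hx hx' => (List.nodup_append.1 h.nodup).2.2 x hx x hx' rfl

lemma exists_eq_cons (h : IsPathList G l a b) : ∃ m, l = a :: m := by
  cases l with
  | nil => simpa using h.head
  | cons x m => exact ⟨m, by have := h.head; simp at this; rw [this]⟩

end IsPathList

lemma exists_first_mem {l : List V} {B : Finset V} (h : ∃ x ∈ l, x ∈ B) :
    ∃ s b r, l = s ++ b :: r ∧ b ∈ B ∧ ∀ x ∈ s, x ∉ B := by
  induction l with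
  | nil => simp at h
  | cons y l ih =>
    by_cases hy : y ∈ B
    · exact ⟨[], y, l, rfl, hy, by simp⟩
    · obtain ⟨s, b, r, rfl, hb, hs⟩ := ih (by
        obtain ⟨x, hx, hxB⟩ := h
        rcases List.mem_cons.1 hx with rfl | hx
        · exact absurd hxB hy
        · exact ⟨x, hx, hxB⟩)
      refine ⟨y :: s, b, r, rfl, hb, ?_⟩
      intro x hx
      rcases List.mem_cons.1 hx with rfl | hx
      · exact hy
      · exact hs x hx

lemma exists_last_mem {l : List V} {B : Finset V} (h : ∃ x ∈ l, x ∈ B) :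
    ∃ s b r, l = s ++ b :: r ∧ b ∈ B ∧ ∀ x ∈ r, x ∉ B := by
  obtain ⟨s, b, r, hl, hb, hs⟩ := exists_first_mem (l := l.reverse) (B := B) (by simpa using h)
  refine ⟨r.reverse, b, s.reverse, ?_, hb, fun x hx => hs x (List.mem_reverse.1 hx)⟩
  have := congrArg List.reverse hl
  simpa using this

lemma reachable_of_isChain {l : List V} (h : l.IsChain G.Adj) :
    ∀ x ∈ l, ∀ y ∈ l, G.Reachable x y := by
  induction l with
  | nil => simp
  | cons a l ih =>
    have ih' := ih h.tail
    have key : ∀ y ∈ l, G.Reachable a y := by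
      intro y hy
      cases l with
      | nil => simp at hy
      | cons b l => exact (List.isChain_cons_cons.1 h).1.reachable.trans (ih' b (by simp) y hy)
    intro x hx y hy
    rcases List.mem_cons.1 hx with h | h <;> rcases List.mem_cons.1 hy with h' | h'
    · rw [h, h']
    · rw [h]; exact key y h'
    · rw [h']; exact (key x h).symm
    · exact ih' x h y h'

/-- Any two vertices of `U` are joined by a path in `U` with at least `k` vertices. -/
def Linked (G : SimpleGraph V) (k : ℕ) (U : Finset V) : Prop :=
  ∀ a ∈ U, ∀ b ∈ U, a ≠ b → ∃ l, IsPathList G l a b ∧ (∀ x ∈ l, x ∈ U) ∧ k ≤ l.length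

/-- Adding an ear preserves `Linked`. -/
lemma Linked.union {k : ℕ} {U : Finset V} (hU : Linked G k U) {u₁ u₂ x₁ x₂ : V} (hu₁ : u₁ ∈ U)
    (hu₂ : u₂ ∈ U) (hne : u₁ ≠ u₂) {l : List V} (hl : IsPathList G l x₁ x₂)
    (hlU : ∀ x ∈ l, x ∉ U) (h₁ : G.Adj u₁ x₁) (h₂ : G.Adj u₂ x₂) :
    Linked G k (U ∪ l.toFinset) := by
  have hsymm : ∀ a b, (∃ p, IsPathList G p a b ∧ (∀ x ∈ p, x ∈ U ∪ l.toFinset) ∧ k ≤ p.length) →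
      ∃ p, IsPathList G p b a ∧ (∀ x ∈ p, x ∈ U ∪ l.toFinset) ∧ k ≤ p.length := by
    rintro a b ⟨p, hp, hpU, hk⟩
    exact ⟨p.reverse, hp.reverse, fun x hx => hpU x (List.mem_reverse.1 hx), by simpa using hk⟩
  have hmix : ∀ a ∈ U, ∀ b ∈ l,
      ∃ p, IsPathList G p a b ∧ (∀ x ∈ p, x ∈ U ∪ l.toFinset) ∧ k ≤ p.length := by
    intro a ha b hb
    obtain ⟨s, r, rfl⟩ := List.append_of_mem hb
    by_cases hau : a = u₁
    · subst hau
      obtain ⟨p, hp, hpU, hk⟩ := hU a ha u₂ hu₂ hne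
      refine ⟨p ++ (b :: r).reverse, hp.append hl.segment_from.reverse h₂ ?_, ?_, ?_⟩
      · intro x hx hx'
        exact hlU x (List.mem_append_right _ (List.mem_reverse.1 hx')) (hpU x hx)
      · intro x hx
        rw [Finset.mem_union, List.mem_toFinset]
        rcases List.mem_append.1 hx with h | h
        · exact Or.inl (hpU x h)
        · exact Or.inr (List.mem_append_right _ (List.mem_reverse.1 h))
      · rw [List.length_append]; omega
    · obtain ⟨p, hp, hpU, hk⟩ := hU a ha u₁ hu₁ hau
      have hsub : ∀ x ∈ s ++ [b], x ∈ s ++ b :: r := by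
        intro x hx
        simp only [List.mem_append, List.mem_cons, List.not_mem_nil, or_false] at hx ⊢
        tauto
      refine ⟨p ++ (s ++ [b]), hp.append hl.segment_to h₁ ?_, ?_, ?_⟩
      · intro x hx hx'
        exact hlU x (hsub x hx') (hpU x hx)
      · intro x hx
        rw [Finset.mem_union, List.mem_toFinset]
        rcases List.mem_append.1 hx with h | h
        · exact Or.inl (hpU x h)
        · exact Or.inr (hsub x h)
      · rw [List.length_append]; omega
  -- Both ends lie on the ear: go from a back to `x₁`, cross `U` from `u₁` to `u₂` on at least k
  -- vertices, and return from `x₂` to b.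
  have hear : ∀ s a m b r, l = s ++ a :: (m ++ b :: r) →
      ∃ p, IsPathList G p a b ∧ (∀ x ∈ p, x ∈ U ∪ l.toFinset) ∧ k ≤ p.length := by
    intro s a m b r hleq
    obtain ⟨p, hp, hpU, hk⟩ := hU u₁ hu₁ u₂ hu₂ hne
    have hl1 : IsPathList G (s ++ a :: (m ++ b :: r)) x₁ x₂ := hleq ▸ hl
    have hl2 : IsPathList G ((s ++ a :: m) ++ b :: r) x₁ x₂ := by simpa using hl1
    have hsub1 : ∀ x ∈ (s ++ [a]).reverse, x ∈ l := by
      intro x hx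
      rw [hleq]
      simp only [List.mem_reverse, List.mem_append, List.mem_cons, List.not_mem_nil, or_false] at hx ⊢
      tauto
    have hsub2 : ∀ x ∈ (b :: r).reverse, x ∈ l := by
      intro x hx
      rw [hleq]
      simp only [List.mem_reverse, List.mem_append, List.mem_cons] at hx ⊢
      tauto
    have hdis : ∀ x ∈ (s ++ [a]).reverse, x ∉ (b :: r).reverse := by
      intro x hx hx'
      refine hl2.disjoint_of_append x ?_ (List.mem_reverse.1 hx')
      simp only [List.mem_reverse, List.mem_append, List.mem_cons, List.not_mem_nil, or_false] at hx ⊢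
      tauto
    refine ⟨(s ++ [a]).reverse ++ (p ++ (b :: r).reverse),
      hl1.segment_to.reverse.append (hp.append hl2.segment_from.reverse h₂ ?_) h₁.symm ?_, ?_, ?_⟩
    · intro x hx hx'
      exact hlU x (hsub2 x hx') (hpU x hx)
    · intro x hx hx'
      rcases List.mem_append.1 hx' with h | h
      · exact hlU x (hsub1 x hx) (hpU x h)
      · exact hdis x hx h
    · intro x hx
      rw [Finset.mem_union, List.mem_toFinset]
      rcases List.mem_append.1 hx with h | h
      · exact Or.inr (hsub1 x h)
      · rcases List.mem_append.1 h with h | h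
        · exact Or.inl (hpU x h)
        · exact Or.inr (hsub2 x h)
    · rw [List.length_append, List.length_append]; omega
  intro a ha b hb hab
  rw [Finset.mem_union, List.mem_toFinset] at ha hb
  rcases ha with ha | ha <;> rcases hb with hb | hb
  · obtain ⟨p, hp, hpU, hk⟩ := hU a ha b hb hab
    exact ⟨p, hp, fun x hx => Finset.mem_union_left _ (hpU x hx), hk⟩
  · exact hmix a ha b hb
  · exact hsymm _ _ (hmix b hb a ha)
  · obtain ⟨s, r, hsr⟩ := List.append_of_mem ha
    rw [hsr] at hb
    rcases List.mem_append.1 hb with h | h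
    · obtain ⟨s', r', rfl⟩ := List.append_of_mem h
      exact hsymm _ _ (hear s' b r' a r (by simpa using hsr))
    · rcases List.mem_cons.1 h with h | h
      · exact absurd h.symm hab
      · obtain ⟨m, r', rfl⟩ := List.append_of_mem h
        exact hear s a m b r' hsr

/-- Two disjoint Hamiltonian connected sets whose sizes add up to more than the circumference are
separated by a single vertex. -/
lemma exists_separating_vertex [Fintype V] {c : ℕ} {A B : Finset V} (hAB : Disjoint A B)
    (hA2 : 2 ≤ #A) (hB2 : 2 ≤ #B)
    (hA : ∀ a ∈ A, ∀ b ∈ A, a ≠ b → ∃ l : List V, l.toFinset = A ∧ IsPathList G l a b)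
    (hB : ∀ a ∈ B, ∀ b ∈ B, a ≠ b → ∃ l : List V, l.toFinset = B ∧ IsPathList G l a b)
    (hcyc : ∀ t, HasCycle G univ t → t ≤ c) (hc : c + 2 ≤ #A + #B) :
    ∃ (v : V) (K : Finset V), v ∉ K ∧ Disjoint A K ∧ #B ≤ #K + 1 ∧
      ∀ x ∈ K, ∀ y, G.Adj x y → y ∈ K ∨ y = v := by
  -- Grow `A` by ears to a maximal set `U` that meets `B` at most once. The component `K` of the
  -- graph outside `U` that contains `b₀` is the side to be cut off.
  obtain ⟨N, ⟨U, hAU, hUB, hU, hUN⟩, hmax⟩ := exists_greatest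
    (P := fun m => ∃ U : Finset V, A ⊆ U ∧ #(U ∩ B) ≤ 1 ∧ Linked G #A U ∧ #U = m)
    (N := Fintype.card V)
    ⟨#A, A, Finset.Subset.refl _, by rw [Finset.disjoint_iff_inter_eq_empty.1 hAB]; simp, by
      intro a ha b hb hab
      obtain ⟨l, hlA, hl⟩ := hA a ha b hb hab
      refine ⟨l, hl, fun x hx => hlA ▸ List.mem_toFinset.2 hx, ?_⟩
      rw [← hlA, List.toFinset_card_of_nodup hl.nodup], rfl⟩
    (by rintro m ⟨U, -, -, -, rfl⟩; exact Finset.card_le_univ U)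
  have hBcard : #(U ∩ B) + #(B \ U) = #B := by
    rw [Finset.inter_comm, Finset.card_inter_add_card_sdiff]
  obtain ⟨b₀, hb₀⟩ := Finset.card_pos.1 (show 0 < #(B \ U) by omega)
  obtain ⟨hb₀B, hb₀U⟩ := Finset.mem_sdiff.1 hb₀
  let G' : SimpleGraph V :=
    { Adj := fun x y => G.Adj x y ∧ x ∉ U ∧ y ∉ U
      symm := ⟨fun x y h => ⟨h.1.symm, h.2.2, h.2.1⟩⟩
      loopless := ⟨fun x h => G.loopless.irrefl x h.1⟩ }
  set K : Finset V := {x | G'.Reachable b₀ x} with hK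
  have hmemK : ∀ x, x ∈ K ↔ G'.Reachable b₀ x := fun x => by simp [hK]
  have hKU : ∀ x ∈ K, x ∉ U := by
    intro x hx
    obtain ⟨p⟩ := (hmemK x).1 hx
    cases hp : p.reverse with
    | nil => exact hb₀U
    | cons h q => exact h.2.1
  have hpath : ∀ x ∈ K, ∀ y ∈ K, ∃ l, IsPathList G l x y ∧ ∀ z ∈ l, z ∈ K := by
    intro x hx y hy
    obtain ⟨p, hp⟩ := (((hmemK x).1 hx).symm.trans ((hmemK y).1 hy)).exists_isPath
    refine ⟨p.support, ⟨p.isChain_adj_support.imp fun _ _ h => h.1, hp.support_nodup, ?_, ?_⟩, ?_⟩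
    · rw [List.head?_eq_some_head p.support_ne_nil, p.head_support]
    · rw [List.getLast?_eq_getLast_of_ne_nil p.support_ne_nil, p.getLast_support]
    · intro z hz
      exact (hmemK z).2 (((hmemK x).1 hx).trans (p.takeUntil z hz).reachable)
  have hchain : ∀ l : List V, l.IsChain G.Adj → (∀ x ∈ l, x ∉ U) → b₀ ∈ l → ∀ x ∈ l, x ∈ K := by
    intro l hl hlU hbl x hx
    refine (hmemK x).2 (reachable_of_isChain (l := l) ?_ b₀ hbl x hx)
    exact List.IsChain.imp_of_mem_imp (fun x y hx hy h => ⟨h, hlU x hx, hlU y hy⟩) hl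
  -- A Hamiltonian path of `B` starting at the vertex of `U ∩ B`, if there is one, keeps the rest of
  -- `B` connected outside `U`.
  have hBK : ∀ b ∈ B, b ∉ U → b ∈ K := by
    intro b hb hbU
    by_cases hv : ∃ v ∈ B, v ∈ U
    · obtain ⟨v, hvB, hvU⟩ := hv
      have hBU : ∀ x ∈ B, x ∈ U → x = v := fun x hx hxU =>
        Finset.card_le_one.1 hUB x (Finset.mem_inter.2 ⟨hxU, hx⟩) v (Finset.mem_inter.2 ⟨hvU, hvB⟩)
      obtain ⟨l, hlB, hl⟩ := hB v hvB b₀ hb₀B fun h => hb₀U (h ▸ hvU)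
      obtain ⟨m, rfl⟩ := hl.exists_eq_cons
      have hmemB : ∀ x, x ∈ v :: m ↔ x ∈ B := fun x => by rw [← hlB, List.mem_toFinset]
      have hvm : v ∉ m := (List.nodup_cons.1 hl.nodup).1
      have hm : ∀ x, x ∈ B → x ∉ U → x ∈ m := fun x hx hxU =>
        (List.mem_cons.1 ((hmemB x).2 hx)).resolve_left fun h => hxU (h ▸ hvU)
      refine hchain m hl.chain.tail ?_ (hm b₀ hb₀B hb₀U) b (hm b hb hbU)
      intro x hx hxU
      exact hvm (hBU x ((hmemB x).1 (List.mem_cons_of_mem _ hx)) hxU ▸ hx)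
    · push Not at hv
      by_cases hbb : b₀ = b
      · exact hbb ▸ (hmemK b₀).2 (Reachable.refl _)
      · obtain ⟨l, hlB, hl⟩ := hB b₀ hb₀B b hb hbb
        refine hchain l hl.chain ?_ hl.head_mem b hl.last_mem
        intro x hx
        exact hv x (hlB ▸ List.mem_toFinset.2 hx)
  -- If `U` meets `B` in v, an attachment other than v gives a cycle through all of `B` and at least
  -- |A| vertices of `U`, sharing only v. If `U` misses `B`, a path through `K` between two
  -- attachments is an ear contradicting maximality when it meets `B` at most once; otherwise,
  -- rerouted through all of `B` between its first and last vertices there, it closes a cycle longer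
  -- than c.
  have hattach : ∀ u₁ ∈ U, ∀ u₂ ∈ U, (∃ x ∈ K, G.Adj u₁ x) → (∃ x ∈ K, G.Adj u₂ x) →
      u₁ = u₂ := by
    intro u₁ hu₁ u₂ hu₂ ⟨x₁, hx₁, hux₁⟩ ⟨x₂, hx₂, hux₂⟩
    by_contra hne
    by_cases hv : ∃ v ∈ B, v ∈ U
    · obtain ⟨v, hvB, hvU⟩ := hv
      have hBU : ∀ x ∈ B, x ∈ U → x = v := fun x hx hxU =>
        Finset.card_le_one.1 hUB x (Finset.mem_inter.2 ⟨hxU, hx⟩) v (Finset.mem_inter.2 ⟨hvU, hvB⟩)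
      obtain ⟨w, hw, x, hx, hwx, hwv⟩ : ∃ w ∈ U, ∃ x ∈ K, G.Adj w x ∧ w ≠ v := by
        by_cases h : u₁ = v
        · exact ⟨u₂, hu₂, x₂, hx₂, hux₂, fun h' => hne (h.trans h'.symm)⟩
        · exact ⟨u₁, hu₁, x₁, hx₁, hux₁, h⟩
      obtain ⟨l, hl, hlK⟩ := hpath x hx b₀ (hBK b₀ hb₀B hb₀U)
      obtain ⟨s, b, r, rfl, hb, hsB⟩ := exists_first_mem ⟨b₀, hl.last_mem, hb₀B⟩
      have hbU : b ∉ U := hKU b (hlK b (by simp))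
      obtain ⟨m, hmB, hm⟩ := hB b hb v hvB fun h => hbU (h ▸ hvU)
      obtain ⟨m, rfl⟩ := hm.exists_eq_cons
      obtain ⟨p, hp, hpU, hpA⟩ := hU v hvU w hw hwv.symm
      obtain ⟨p, rfl⟩ := hp.exists_eq_cons
      have hmB' : ∀ y ∈ m, y ∈ B := fun y hy =>
        hmB ▸ List.mem_toFinset.2 (List.mem_cons_of_mem _ hy)
      have hbm : b ∉ m := (List.nodup_cons.1 hm.nodup).1
      have hvp : v ∉ p := (List.nodup_cons.1 hp.nodup).1
      have hsK : ∀ y ∈ s ++ [b], y ∈ K := by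
        intro y hy
        refine hlK y ?_
        simp only [List.mem_append, List.mem_cons, List.not_mem_nil, or_false] at hy ⊢
        tauto
      have q₁ := hl.segment_to.glue hm (by
        intro y hy hym
        rcases List.mem_append.1 hy with h | h
        · exact hsB y h (hmB' y hym)
        · rw [List.mem_singleton] at h
          exact hbm (h ▸ hym))
      have q₂ := q₁.glue hp (by
        intro y hy hyp
        have hyU := hpU y (List.mem_cons_of_mem _ hyp)
        rcases List.mem_append.1 hy with h | h
        · exact hKU y (hsK y h) hyU
        · exact hvp (hBU y (hmB' y h) hyU ▸ hyp))
      have hmlen : m.length + 1 = #B := by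
        rw [← hmB, List.toFinset_card_of_nodup hm.nodup, List.length_cons]
      rw [List.length_cons] at hpA
      have hlen : c < (s ++ [b] ++ m ++ p).length := by simp; omega
      have := hcyc _ (q₂.hasCycle hwx (by simp; omega) fun y _ => Finset.mem_univ y)
      omega
    · push Not at hv
      obtain ⟨l, hl, hlK⟩ := hpath x₁ hx₁ x₂ hx₂
      by_cases hlB : #(l.toFinset ∩ B) ≤ 1
      · have hlU : ∀ x ∈ l, x ∉ U := fun x hx => hKU x (hlK x hx)
        have := hmax _ ⟨U ∪ l.toFinset, hAU.trans Finset.subset_union_left, ?_,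
          hU.union hu₁ hu₂ hne hl hlU hux₁ hux₂, rfl⟩
        · have hlt : #U < #(U ∪ l.toFinset) := by
            refine Finset.card_lt_card ((Finset.ssubset_iff_of_subset
              Finset.subset_union_left).2 ⟨x₁, ?_, hKU x₁ hx₁⟩)
            exact Finset.mem_union_right _ (List.mem_toFinset.2 hl.head_mem)
          omega
        · refine le_trans (Finset.card_le_card fun x hx => ?_) hlB
          rw [Finset.mem_inter, Finset.mem_union] at hx
          exact Finset.mem_inter.2 ⟨hx.1.resolve_left (hv x hx.2), hx.2⟩
      · push Not at hlB
        obtain ⟨y₁, hy₁, y₂, hy₂, hyy⟩ := Finset.one_lt_card.1 hlB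
        rw [Finset.mem_inter, List.mem_toFinset] at hy₁ hy₂
        obtain ⟨s, b₁, r, rfl, hb₁, hsB⟩ := exists_first_mem ⟨y₁, hy₁⟩
        obtain ⟨s', b₂, r', rfl, hb₂, hrB⟩ := exists_last_mem (l := r) (B := B) (by
          by_contra! hr
          have hall : ∀ y, y ∈ s ++ b₁ :: r ∧ y ∈ B → y = b₁ := by
            rintro y ⟨hy, hyB⟩
            rcases List.mem_append.1 hy with h | h
            · exact absurd hyB (hsB y h)
            · exact (List.mem_cons.1 h).resolve_right fun h => hr y h hyB
          exact hyy ((hall y₁ hy₁).trans (hall y₂ hy₂).symm))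
        have hl2 : IsPathList G ((s ++ b₁ :: s') ++ b₂ :: r') x₁ x₂ := by simpa using hl
        have hdis := hl2.disjoint_of_append
        have hb12 : b₁ ≠ b₂ := fun h => hdis b₁ (by simp) (by simp [h])
        obtain ⟨m, hmB, hm⟩ := hB b₁ hb₁ b₂ hb₂ hb12
        obtain ⟨m, rfl⟩ := hm.exists_eq_cons
        obtain ⟨p, hp, hpU, hpA⟩ := hU u₂ hu₂ u₁ hu₁ (Ne.symm hne)
        have hmB' : ∀ y ∈ m, y ∈ B := fun y hy =>
          hmB ▸ List.mem_toFinset.2 (List.mem_cons_of_mem _ hy)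
        have hbm : b₁ ∉ m := (List.nodup_cons.1 hm.nodup).1
        have q₁ := hl.segment_to.glue hm (by
          intro y hy hym
          rcases List.mem_append.1 hy with h | h
          · exact hsB y h (hmB' y hym)
          · rw [List.mem_singleton] at h
            exact hbm (h ▸ hym))
        have q₂ := q₁.glue hl2.segment_from (by
          intro y hy hyr
          rcases List.mem_append.1 hy with h | h
          · refine hdis y ?_ (List.mem_cons_of_mem _ hyr)
            simp only [List.mem_append, List.mem_cons, List.not_mem_nil, or_false] at h ⊢
            tauto
          · exact hrB y hyr (hmB' y h))
        have q₃ := hp.append q₂ hux₁ (by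
          intro y hy hy'
          have hyU := hpU y hy
          rcases List.mem_append.1 hy' with h | h
          · rcases List.mem_append.1 h with h | h
            · refine hKU y (hlK y ?_) hyU
              simp only [List.mem_append, List.mem_cons, List.not_mem_nil, or_false] at h ⊢
              tauto
            · exact hv y (hmB' y h) hyU
          · refine hKU y (hlK y ?_) hyU
            simp [h])
        have hmlen : m.length + 1 = #B := by
          rw [← hmB, List.toFinset_card_of_nodup hm.nodup, List.length_cons]
        have hlen : c < (p ++ (s ++ [b₁] ++ m ++ r')).length := by simp; omega
        have := hcyc _ (q₃.hasCycle hux₂.symm (by simp; omega) fun y _ => Finset.mem_univ y)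
        omega
  have hclosed : ∀ x ∈ K, ∀ y, G.Adj x y → y ∉ U → y ∈ K := by
    intro x hx y hxy hyU
    refine (hmemK y).2 (((hmemK x).1 hx).trans ?_)
    exact Adj.reachable (G := G') ⟨hxy, hKU x hx, hyU⟩
  have hAK : Disjoint A K := Finset.disjoint_left.2 fun x hx hxK => hKU x hxK (hAU hx)
  have hBcard' : #B ≤ #K + 1 := by
    have : #(B \ U) ≤ #K := Finset.card_le_card fun x hx =>
      hBK x (Finset.mem_sdiff.1 hx).1 (Finset.mem_sdiff.1 hx).2
    omega
  by_cases hex : ∃ v ∈ U, ∃ x ∈ K, G.Adj v x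
  · obtain ⟨v, hvU, hvK⟩ := hex
    refine ⟨v, K, fun h => hKU v h hvU, hAK, hBcard', fun x hx y hxy => ?_⟩
    by_cases hyU : y ∈ U
    · exact Or.inr (hattach y hyU v hvU ⟨x, hx, hxy.symm⟩ hvK)
    · exact Or.inl (hclosed x hx y hxy hyU)
  · push Not at hex
    obtain ⟨v, hv⟩ := Finset.card_pos.1 (show 0 < #A by omega)
    refine ⟨v, K, fun h => hKU v h (hAU hv), hAK, hBcard', fun x hx y hxy => Or.inl ?_⟩
    exact hclosed x hx y hxy fun hyU => hex y hyU x hx hxy.symm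

/-! ### Stability: two dense ends -/

lemma defect_cast (c : ℕ) (S : Finset V) : (defect G c S : ℝ) = c * #S - degSum G S := by
  unfold defect; push_cast; ring

/-- Small sets have large defect. -/
lemma card_mul_le_defect (c : ℕ) (S : Finset V) :
    (#S : ℝ) * (c + 1 - #S) ≤ defect G c S := by
  rw [defect_cast]
  have h : (degSum G S : ℝ) ≤ #S * (#S - 1) := by exact_mod_cast degSum_le_int (G := G) S
  linarith

/-- An almost complete set of almost `c` vertices of large minimum degree. -/
structure IsDenseEnd (G : SimpleGraph V) (c : ℕ) (n ε : ℝ) (X : Finset V) : Prop where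
  card_lt : #X + 1 ≤ c
  le_card : (c : ℝ) - 1 - 4 * ε ≤ #X
  sum_le : ((c : ℝ) - 2) * #X - degSum G X ≤ ε * n
  le_degIn : ∀ x ∈ X, c ≤ 2 * degIn G X x + 1

/-- The remainder has nonnegative defect, so splitting off X can lower the defect by at most εn.
Hence (c - 1 - |X|)|X| ≤ εn, and |X| > c/2 > n/4 turns this into the bound 4ε on c - 1 - |X|. -/
lemma exists_isDenseEnd {c : ℕ} {n ε : ℝ} (hε : 0 ≤ ε) (hc : 2 ≤ c) (hnc : n < 2 * c)
    {S : Finset V} (hcyc : ∀ t, HasCycle G S t → t ≤ c) (hS : S.Nonempty)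
    (hdeg : ∀ v ∈ S, c < 2 * degIn G S v) (hdef : (defect G c S : ℝ) ≤ ε * n) :
    ∃ X ⊆ S, IsDenseEnd G c n ε X ∧ ∑ x ∈ X, degIn G (S \ X) x ≤ #X ∧
      (defect G c (S \ X) : ℝ) ≤ ε * n := by
  obtain ⟨X, hXS, hcX, hXc, hXdeg, hXsum, hXdef⟩ := exists_dense_end hc hS hcyc hdeg
  have h1 : ((defect G c (S \ X) : ℤ) : ℝ) + (((c : ℝ) - 2) * #X - degSum G X) ≤
      defect G c S := by exact_mod_cast hXdef
  have h2 : (0 : ℝ) ≤ defect G c (S \ X) := by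
    exact_mod_cast defect_nonneg hc fun t ht => hcyc t (ht.mono Finset.sdiff_subset)
  have h3 : (degSum G X : ℝ) ≤ #X * (#X - 1) := by exact_mod_cast degSum_le_int (G := G) X
  have h4 : (#X : ℝ) + 1 ≤ c := by exact_mod_cast hXc
  have h5 : (c : ℝ) < 2 * #X := by exact_mod_cast hcX
  have h6 : (0 : ℝ) ≤ (c - 1 - #X) * #X := mul_nonneg (by linarith) (Nat.cast_nonneg _)
  refine ⟨X, hXS, ⟨hXc, ?_, by linarith, hXdeg⟩, hXsum, by linarith⟩
  have h7 : ((c : ℝ) - 1 - #X) * #X ≤ ε * n := by linarith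
  have h8 : ε * n ≤ ε * (4 * #X) := mul_le_mul_of_nonneg_left (by linarith) hε
  have h9 : (0 : ℝ) < #X := by linarith [Nat.cast_nonneg (α := ℝ) c]
  have := le_of_mul_le_mul_right (h7.trans (h8.trans_eq (by ring : _ = 4 * ε * #X))) h9
  linarith

/-- The core left after deleting vertices of small degree from a set of small defect. -/
lemma exists_core_of_defect_le {c : ℕ} {n ε : ℝ} (hε : 1 / 2 < ε) (hεn : 100000 * ε < n)
    (hnc : n < 2 * c) {S : Finset V} (hcS : c ≤ 2 * #S + 1)
    (hdef : (defect G c S : ℝ) ≤ ε * n) :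
    ∃ S₁ ⊆ S, S₁.Nonempty ∧ (∀ v ∈ S₁, c < 2 * degIn G S₁ v) ∧
      ∀ k, #S₁ ≤ k → k ≤ #S → ∃ U, S₁ ⊆ U ∧ U ⊆ S ∧ #U = k ∧ (defect G c U : ℝ) ≤ ε * n := by
  obtain ⟨S₁, hS₁, hcore, hr, hU⟩ := exists_core (G := G) c (c / 2) S (by omega)
  have hU' : ∀ k, #S₁ ≤ k → k ≤ #S →
      ∃ U, S₁ ⊆ U ∧ U ⊆ S ∧ #U = k ∧ (defect G c U : ℝ) ≤ ε * n := by
    intro k h1 h2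
    obtain ⟨U, hU1, hU2, hU3, hU4⟩ := hU k h1 h2
    exact ⟨U, hU1, hU2, hU3, le_trans (by exact_mod_cast hU4) hdef⟩
  have hc : 2 ≤ c := by
    have : (2 : ℝ) ≤ c := by linarith
    exact_mod_cast this
  refine ⟨S₁, hS₁, Finset.card_pos.1 (by omega), ?_, hU'⟩
  rcases hcore with h | h
  · exfalso
    -- Deletion cannot go on down to c/2 vertices: a set of that size has defect of order n², far
    -- above εn.
    obtain ⟨U, -, -, hUc, hUdef⟩ := hU' _ le_rfl (Finset.card_le_card hS₁)
    have h1 := card_mul_le_defect (G := G) c U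
    have h2 : 2 * #U ≤ c := by omega
    have h3 : c ≤ 2 * #U + 1 := by omega
    have h2' : (2 * #U : ℝ) ≤ c := by exact_mod_cast h2
    have h3' : (c : ℝ) ≤ 2 * #U + 1 := by exact_mod_cast h3
    have h4 : (#U : ℝ) * (n / 4) ≤ #U * (c + 1 - #U) :=
      mul_le_mul_of_nonneg_left (by linarith) (Nat.cast_nonneg _)
    have h5 : 4 * ε * (n / 4) < #U * (n / 4) := mul_lt_mul_of_pos_right (by linarith) (by linarith)
    linarith
  · exact h

/-- A graph with small defect and no long cycles contains two disjoint almost complete sets. -/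
lemma exists_two_isDenseEnd {c : ℕ} {ε : ℝ} {S : Finset V} (hε : 1 / 2 < ε)
    (hεn : 100000 * ε < #S) (hnc : (#S : ℝ) < 2 * c) (hcn : (c : ℝ) < #S / 2 + ε)
    (hcyc : ∀ t, HasCycle G S t → t ≤ c) (hdef : (defect G c S : ℝ) ≤ ε * #S) :
    ∃ A ⊆ S, ∃ B ⊆ S, Disjoint A B ∧ IsDenseEnd G c #S ε A ∧ IsDenseEnd G c #S ε B := by
  have hc : 2 ≤ c := by
    have : (2 : ℝ) ≤ c := by linarith
    exact_mod_cast this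
  have hcS : c ≤ 2 * #S + 1 := by
    have : (c : ℝ) ≤ 2 * #S + 1 := by linarith
    exact_mod_cast this
  obtain ⟨S₁, hS₁, hne, hcore, hU⟩ := exists_core_of_defect_le hε hεn hnc hcS hdef
  obtain ⟨U₁, hU₁, -, hU₁c, hU₁def⟩ := hU _ le_rfl (Finset.card_le_card hS₁)
  have hU₁S : S₁ = U₁ := Finset.eq_of_subset_of_card_le hU₁ hU₁c.le
  rw [← hU₁S] at hU₁def
  obtain ⟨A, hAS₁, hA, hAsum, hrest⟩ := exists_isDenseEnd (by linarith) hc hnc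
    (fun t ht => hcyc t (ht.mono hS₁)) hne hcore hU₁def
  rcases Nat.lt_or_ge (2 * #(S₁ \ A) + 1) c with hsmall | hbig
  · exfalso
    -- A remainder s below c/2 has defect at least sn/4, so s ≤ 4ε. The last ⌈40ε⌉ deleted vertices
    -- are then put back, with the defect still at most εn.
    have hs : (#(S₁ \ A) : ℝ) ≤ 4 * ε := by
      have h1 := card_mul_le_defect (G := G) c (S₁ \ A)
      have h2 : (2 * #(S₁ \ A) + 1 : ℝ) < c := by exact_mod_cast hsmall
      have h3 : (#(S₁ \ A) : ℝ) * (#S / 4) ≤ #(S₁ \ A) * (c + 1 - #(S₁ \ A)) :=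
        mul_le_mul_of_nonneg_left (by linarith) (Nat.cast_nonneg _)
      exact le_of_mul_le_mul_right
        ((h3.trans (h1.trans hrest)).trans_eq (by ring : _ = 4 * ε * ((#S : ℝ) / 4)))
        (by linarith)
    have hS₁card : (#(S₁ \ A) : ℝ) + #A = #S₁ := by
      exact_mod_cast Finset.card_sdiff_add_card_eq_card hAS₁
    have hAc : (#A : ℝ) + 1 ≤ c := by exact_mod_cast hA.card_lt
    have hL1 := Nat.le_ceil (40 * ε)
    have hL2 := Nat.ceil_lt_add_one (show 0 ≤ 40 * ε by linarith)
    obtain ⟨U, hSU, hUS, hUc, hUdef⟩ := hU (#S₁ + ⌈40 * ε⌉₊) (by omega) (by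
      have : (#S₁ : ℝ) + ⌈40 * ε⌉₊ ≤ #S := by linarith
      exact_mod_cast this)
    have hUL : #(U \ S₁) = ⌈40 * ε⌉₊ := by
      rw [Finset.card_sdiff_of_subset hSU, hUc]; omega
    exact false_of_single_dense_end hε hεn hnc hAS₁ hSU (fun t ht => hcyc t (ht.mono hUS))
      hA.card_lt hA.le_card hA.sum_le hA.le_degIn hAsum hs (by rw [hUL]; exact hL1)
      (by rw [hUL]; linarith) hUdef
  · obtain ⟨S₃, hS₃, hne₃, hcore₃, hU₃⟩ := exists_core_of_defect_le hε hεn hnc hbig hrest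
    obtain ⟨U₃, hU₃, -, hU₃c, hU₃def⟩ := hU₃ _ le_rfl (Finset.card_le_card hS₃)
    have hU₃S : S₃ = U₃ := Finset.eq_of_subset_of_card_le hU₃ hU₃c.le
    rw [← hU₃S] at hU₃def
    have hS₃S : S₃ ⊆ S := hS₃.trans (Finset.sdiff_subset.trans hS₁)
    obtain ⟨B, hBS₃, hB, -, -⟩ := exists_isDenseEnd (by linarith) hc hnc
      (fun t ht => hcyc t (ht.mono hS₃S)) hne₃ hcore₃ hU₃def
    refine ⟨A, hAS₁.trans hS₁, B, hBS₃.trans hS₃S, ?_, hA, hB⟩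
    exact Finset.disjoint_left.2 fun x hx hx' =>
      (Finset.mem_sdiff.1 (hS₃ (hBS₃ hx'))).2 hx

lemma IsDenseEnd.exists_hamiltonPath {c : ℕ} {n ε : ℝ} {X : Finset V} (h : IsDenseEnd G c n ε X)
    (hε : 1 / 2 < ε) (hεn : 100000 * ε < n) (hnc : n < 2 * c) :
    ∀ a ∈ X, ∀ b ∈ X, a ≠ b → ∃ l : List V, l.toFinset = X ∧ IsPathList G l a b := by
  intro a ha b hb hab
  have := exists_hamiltonPath_of_dense (Y := ∅) hε hεn hnc (Finset.disjoint_empty_right _)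
    h.card_lt h.le_card h.sum_le h.le_degIn (by simp) (by simp; linarith)
    (Finset.mem_union_left _ ha) (Finset.mem_union_left _ hb) hab
  rwa [Finset.union_empty] at this

/-! ### Balanced separation and conclusion -/

/-- A graph with more than `n ^ 2 / 4` edges and no long cycles is separated by a vertex into two
parts of about the same size. -/
lemma exists_balanced_separation [Fintype V] {γ : ℝ} (hγ₁ : γ < 1 / 10 ^ 5) {c : ℕ}
    (hc : 2 ≤ c) (hcn : (c : ℝ) < (1 / 2 + γ) * Fintype.card V)
    (hcyc : ∀ t, HasCycle G univ t → t ≤ c)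
    (hG : (Fintype.card V : ℝ) ^ 2 < 2 * degSum G univ) :
    ∃ (v : V) (K L : Finset V), v ∉ K ∧ v ∉ L ∧ Disjoint K L ∧ (∀ x, x ≠ v → x ∈ K ∨ x ∈ L) ∧
      (∀ x ∈ K, ∀ y ∈ L, ¬ G.Adj x y) ∧
      (1 / 2 - 900 * γ) * Fintype.card V < #K ∧ (1 / 2 - 900 * γ) * Fintype.card V < #L ∧
      #K + #L + 1 = Fintype.card V := by
  obtain ⟨n, hn⟩ : ∃ n, Fintype.card V = n := ⟨_, rfl⟩
  have hun : #(univ : Finset V) = n := by rw [Finset.card_univ, hn]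
  rw [hn] at hcn hG ⊢
  have hn0 : (0 : ℝ) < n := by
    rcases Nat.eq_zero_or_pos n with h | h
    · subst h
      simp at hcn
      linarith [Nat.cast_nonneg (α := ℝ) c]
    · exact_mod_cast h
  have h0 : (0 : ℝ) ≤ defect G c univ := by exact_mod_cast defect_nonneg hc hcyc
  have hd := defect_cast (G := G) c univ
  rw [hun] at hd
  have hnc : (n : ℝ) < 2 * c := by
    have : (n : ℝ) * n < 2 * c * n := by nlinarith
    exact lt_of_mul_lt_mul_right this hn0.le
  -- Integrality matters: n + 1 ≤ 2c < n + 2ε gives ε > 1/2, so additive constants are absorbed by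
  -- multiples of ε and n > 50000.
  have hnc' : (n : ℝ) + 1 ≤ 2 * c := by
    have : n < 2 * c := by exact_mod_cast hnc
    exact_mod_cast this
  obtain ⟨ε, hεdef⟩ : ∃ ε, ε = γ * n := ⟨_, rfl⟩
  have hcn' : (c : ℝ) < n / 2 + ε := by rw [hεdef]; linarith
  have hε : 1 / 2 < ε := by linarith
  have hεn : 100000 * ε < n := by rw [hεdef]; nlinarith
  have hdef : (defect G c univ : ℝ) ≤ ε * n := by
    have : (c : ℝ) * n ≤ (n / 2 + ε) * n := mul_le_mul_of_nonneg_right hcn'.le hn0.le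
    nlinarith
  have h900 : (1 / 2 - 900 * γ) * n = n / 2 - 900 * ε := by rw [hεdef]; ring
  rw [h900]
  obtain ⟨A, -, B, -, hAB, hA, hB⟩ := exists_two_isDenseEnd (G := G) (S := univ) (c := c) hε
    (by rw [hun]; exact hεn) (by rw [hun]; exact hnc) (by rw [hun]; exact hcn') hcyc
    (by rw [hun]; exact hdef)
  rw [hun] at hA hB
  have hAl := hA.le_card
  have hBl := hB.le_card
  obtain ⟨v, K, hvK, hAK, hBK, hK⟩ := exists_separating_vertex hAB
    (by have : (2 : ℝ) ≤ #A := by linarith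
        exact_mod_cast this)
    (by have : (2 : ℝ) ≤ #B := by linarith
        exact_mod_cast this)
    (hA.exists_hamiltonPath hε hεn hnc) (hB.exists_hamiltonPath hε hεn hnc) hcyc
    (by have : (c : ℝ) + 2 ≤ #A + #B := by linarith
        exact_mod_cast this)
  have hcard : #(insert v K) = #K + 1 := Finset.card_insert_of_notMem hvK
  have hcompl : #(univ \ insert v K) + #(insert v K) = n := by
    rw [← hun]; exact Finset.card_sdiff_add_card_eq_card (Finset.subset_univ _)
  have hAL : #A ≤ #(univ \ insert v K) + 1 := by
    refine le_trans (Finset.card_le_card (t := insert v (univ \ insert v K)) fun x hx => ?_)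
      (Finset.card_insert_le _ _)
    have hxK : x ∉ K := fun h => Finset.disjoint_left.1 hAK hx h
    simp only [Finset.mem_insert, Finset.mem_sdiff, Finset.mem_univ, true_and, not_or]
    tauto
  refine ⟨v, K, univ \ insert v K, hvK, by simp, ?_, ?_, ?_, ?_, ?_, by omega⟩
  · exact Finset.disjoint_left.2 fun x hx hx' =>
      (Finset.mem_sdiff.1 hx').2 (Finset.mem_insert_of_mem hx)
  · intro x hxv
    by_cases hx : x ∈ K
    · exact Or.inl hx
    · exact Or.inr (by simp [hx, hxv])
  · intro x hx y hy hxy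
    rw [Finset.mem_sdiff, Finset.mem_insert, not_or] at hy
    rcases hK x hx y hxy with h | h
    · exact hy.2.2 h
    · exact hy.2.1 h
  · have : (#B : ℝ) ≤ #K + 1 := by exact_mod_cast hBK
    linarith
  · have : (#A : ℝ) ≤ #(univ \ insert v K) + 1 := by exact_mod_cast hAL
    linarith

lemma deleteVerts_eq_sup {v : V} {K L : Finset V} (hvK : v ∉ K) (hvL : v ∉ L)
    (hKL : ∀ x, x ≠ v → x ∈ K ∨ x ∈ L) (hadj : ∀ x ∈ K, ∀ y ∈ L, ¬ G.Adj x y) :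
    (⊤ : G.Subgraph).deleteVerts {v} =
      (⊤ : G.Subgraph).induce (K : Set V) ⊔ (⊤ : G.Subgraph).induce (L : Set V) := by
  have hne : ∀ x, x ∈ K ∨ x ∈ L → x ≠ v := by
    rintro x (h | h) rfl
    exacts [hvK h, hvL h]
  ext x y
  · simp only [Subgraph.verts_top, Subgraph.verts_sup,
      Subgraph.induce_verts, Set.mem_sdiff, Set.mem_univ, true_and, Set.mem_singleton_iff,
      Set.mem_union, Finset.mem_coe]
    exact ⟨hKL x, hne x⟩
  · simp only [Subgraph.verts_top, Set.mem_sdiff, Set.mem_univ, true_and,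
      Set.mem_singleton_iff, Subgraph.top_adj, Subgraph.sup_adj, Subgraph.induce_adj,
      Finset.mem_coe]
    constructor
    · rintro ⟨hx, hy, hxy⟩
      rcases hKL x hx with h | h <;> rcases hKL y hy with h' | h'
      · exact Or.inl ⟨h, h', hxy⟩
      · exact absurd hxy (hadj x h y h')
      · exact absurd hxy.symm (hadj y h' x h)
      · exact Or.inr ⟨h, h', hxy⟩
    · rintro (⟨h, h', hxy⟩ | ⟨h, h', hxy⟩)
      · exact ⟨hne x (Or.inl h), hne y (Or.inl h'), hxy⟩
      · exact ⟨hne x (Or.inr h), hne y (Or.inr h'), hxy⟩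

lemma degSum_univ [Fintype V] (G : SimpleGraph V) [Fintype G.edgeSet] :
    degSum G univ = 2 * #G.edgeFinset := by
  have h := G.sum_degrees_eq_twice_card_edges
  have e : ∀ v, degIn G univ v = G.degree v := by
    intro v
    unfold degIn
    rw [← card_neighborFinset_eq_degree]
    congr 1
    ext w
    simp
  unfold degSum
  simp only [e]
  convert h

end CycleStability

theorem theorem1 (γ : ℝ) (hγ₀ : 0 < γ) (hγ₁ : γ < 1 / 10 ^ 5)
    {V : Type*} [Fintype V] (G : SimpleGraph V) [Fintype G.edgeSet]
    (n : ℕ) (hn : Fintype.card V = n)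
    (hG : (n : ℝ) ^ 2 / 4 < (G.edgeFinset.card : ℝ)) :
    (∀ t : ℕ, 3 ≤ t → t ≤ ⌈(1 / 2 + γ) * (n : ℝ)⌉₊ → (SimpleGraph.cycleGraph t).IsContained G) ∨
    (∃ (v : V) (H₁ H₂ : G.Subgraph),
      (⊤ : G.Subgraph).deleteVerts {v} = H₁ ⊔ H₂ ∧
      Disjoint H₁.verts H₂.verts ∧
      (1 / 2 - 900 * γ) * (n : ℝ) < (H₁.verts.ncard : ℝ) ∧
      H₁.verts.ncard ≤ H₂.verts.ncard ∧
      (H₂.verts.ncard : ℝ) < (1 / 2 + 900 * γ) * (n : ℝ)) := by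
  classical
  rw [or_iff_not_imp_left]
  intro hno
  obtain ⟨t, ht⟩ := not_forall.1 hno
  obtain ⟨ht3, ht'⟩ := Classical.not_imp.1 ht
  obtain ⟨htk, hnot⟩ := Classical.not_imp.1 ht'
  subst hn
  have hsum : (Fintype.card V : ℝ) ^ 2 < 2 * CycleStability.degSum G Finset.univ := by
    rw [CycleStability.degSum_univ]; push_cast; linarith
  -- Any cycle at least as long as the ceiling would produce the missing `C_t`. The subtraction is
  -- not truncated, as 3 ≤ t is at most the ceiling.
  have hcyc : ∀ c, CycleStability.HasCycle G Finset.univ c →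
      c ≤ ⌈(1 / 2 + γ) * (Fintype.card V : ℝ)⌉₊ - 1 := by
    intro c hc
    by_contra! hlt
    refine hnot (CycleStability.HasCycle.isContained
      (CycleStability.hasCycle_of_le ?_ ht3 (by omega) hc))
    rw [Finset.card_univ, ← sq]
    exact_mod_cast hsum
  have hceil := Nat.ceil_lt_add_one (show 0 ≤ (1 / 2 + γ) * (Fintype.card V : ℝ) by positivity)
  obtain ⟨v, K, L, hvK, hvL, hKL, hcover, hadj, hK, hL, hcard⟩ :=
    CycleStability.exists_balanced_separation (G := G) hγ₁ (by omega)
      (by rw [Nat.cast_sub (by omega)]; push_cast; linarith) hcyc hsum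
  -- The two sides have n - 1 vertices in all, so the lower bound on the smaller is an upper bound
  -- on the larger.
  have hcard' : (K.card : ℝ) + L.card + 1 = Fintype.card V := by exact_mod_cast hcard
  rcases le_total K.card L.card with hle | hle
  · refine ⟨v, (⊤ : G.Subgraph).induce K, (⊤ : G.Subgraph).induce L,
      CycleStability.deleteVerts_eq_sup hvK hvL hcover hadj, ?_, ?_, ?_, ?_⟩
    · simpa using hKL
    · simpa using hK
    · simpa using hle
    · simp only [SimpleGraph.Subgraph.induce_verts, Set.ncard_coe_finset]
      linarith
  · refine ⟨v, (⊤ : G.Subgraph).induce L, (⊤ : G.Subgraph).induce K,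
      CycleStability.deleteVerts_eq_sup hvL hvK (fun x hx => (hcover x hx).symm)
        (fun x hx y hy h => hadj y hy x hx h.symm), ?_, ?_, ?_, ?_⟩
    · simpa using hKL.symm
    · simpa using hL
    · simpa using hle
    · simp only [SimpleGraph.Subgraph.induce_verts, Set.ncard_coe_finset]
      linarith
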